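/- Setting. Let $I$ be a countable set of tasks with a probability distribution $p$ (task $i$ has probability $p_i$). Task $i$ has a data distribution $\mathcal D_i$ and sample losses $f_i(\cdot,\theta):\mathbb R^d\to\mathbb R$, differentiable in the parameter; put $f_i(w)=\mathbb E_{\theta\sim\mathcal D_i}[f_i(w,\theta)]$, $f(w)=\mathbb E_{i\sim p}[f_i(w)]$ and, for $\alpha>0$, $$F(w)=\mathbb E_{i\sim p}\big[f_i(w-\alpha\nabla f_i(w))\big].$$ For a batch $\mathcal S$ of data points write $\tilde\nabla f_i(w,\mathcal S)=\frac1{|\mathcal S|}\sum_{\theta\in\mathcal S}\nabla f_i(w,\theta)$. FO-MAML. Fix $w_0$. At iteration $k$ draw independently $B$ tasks $i\in\mathcal B_k$ and $B'$ tasks $j\in\mathcal B'_k$ i.i.d. from $p$; for each $i\in\mathcal B_k$ draw independent batches $\mathcal D^i_{in},\mathcal D^i_o$ of $D_{in}$ and $D_o$ i.i.d. points of $\mathcal D_i$, and for each $j\in\mathcal B'_k$ a batch $\mathcal D^j_\beta$ of $D_\beta$ i.i.d. points of $\mathcal D_j$; all draws are independent across slots and iterations. Then $$w_{k+1}=w_k-\frac{\beta_k}{B}\sum_{i\in\mathcal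 B_k}\tilde\nabla f_i\big(w_k-\alpha\tilde\nabla f_i(w_k,\mathcal D^i_{in}),\mathcal D^i_o\big),\qquad \beta_k=\frac{\tilde\beta(w_k)}{18},\qquad \tilde\beta(w)=\frac{1}{4L+\frac{2\rho\alpha}{B'}\sum_{j\in\mathcal B'_k}\|\tilde\nabla f_j(w,\mathcal D^j_\beta)\|}.$$ Assumptions. Let $L>0$, $\rho\ge0$, $\sigma>0$, $\tilde\sigma\ge0$. (1) $F$ is bounded below; put $\Delta=F(w_0)-\inf F$. (2) Every $f_i$ is twice continuously differentiable and $\|\nabla f_i(w)-\nabla f_i(u)\|\le L\|w-u\|$ for all $w,u$. (3) $\|\nabla^2f_i(w)-\nabla^2f_i(u)\|\le\rho\|w-u\|$ for all $i,w,u$. (4) $\mathbb E_{i\sim p}\|\nabla f(w)-\nabla f_i(w)\|^2\le\sigma^2$ for all $w$. (5) For all $i,w$: $\mathbb E_\theta[\nabla f_i(w,\theta)]=\nabla f_i(w)$ and $\mathbb E_\theta\|\nabla f_i(w,\theta)-\nabla f_i(w)\|^2\le\tilde\sigma^2$. (6) $\rho\alpha/L\le c_1$ and $\sigma^2+\tilde\sigma^2\le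 c_2$. Theorem. For all $c_1,c_2$ there is a constant $C>0$, depending only on $c_1$ and $c_2$, such that the following holds for every setting as above. Suppose $0<\alpha\le\frac1{10L}$, $B\ge20$, $D_{in},D_o\ge1$, $B'\ge\max\{1,\lceil\frac12(\rho\alpha\sigma/L)^2\rceil\}$ and $D_\beta\ge\max\{1,\lceil(2\rho\alpha\tilde\sigma/L)^2\rceil\}$. Then $F$ is well defined and differentiable, and for every $0<\epsilon<1$ some iterate $w_k$ of FO-MAML with $$k\le C\,\Delta\,\min\left\{\frac{L}{\epsilon^2},\ \frac{L}{\sigma^2(\alpha^2L^2+B^{-1})}+\frac{L(BD_o+D_{in})}{\tilde\sigma^2}\right\}$$ (the last summand being omitted if $\tilde\sigma=0$) satisfies $$\mathbb E\big[\|\nabla F(w_k)\|\big]\le C\sqrt{\sigma^2\Big(\alpha^2L^2+\frac1B\Big)+\frac{\tilde\sigma^2}{BD_o}+\frac{\tilde\sigma^2}{D_{in}}}+\epsilon .$$ -/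

import Mathlib

open MeasureTheory ProbabilityTheory
open scoped Gradient

noncomputable section

namespace FOMAML

/-- The parameter space `ℝᵈ` with its Euclidean norm. -/
abbrev Param (d : ℕ) : Type := EuclideanSpace ℝ (Fin d)

/-- The loss of task `i`: the expectation of the sample loss `ℓ i w θ` over a data point `θ`
drawn from the data distribution `D i` of that task. -/
def taskLoss {d : ℕ} {I Θ : Type*} [MeasurableSpace Θ] (D : I → Measure Θ)
    (ℓ : I → Param d → Θ → ℝ) (i : I) (w : Param d) : ℝ :=
  ∫ θ, ℓ i w θ ∂(D i)

/-- The average loss `f(w) = E_{i ∼ p} f_i(w)`. -/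
def meanLoss {d : ℕ} {I Θ : Type*} [MeasurableSpace I] [MeasurableSpace Θ] (p : Measure I)
    (D : I → Measure Θ) (ℓ : I → Param d → Θ → ℝ) (w : Param d) : ℝ :=
  ∫ i, taskLoss D ℓ i w ∂p

/-- The loss of task `i` after one gradient step: `F_i(w) = f_i(w - α ∇f_i(w))`. -/
def adaptedLoss {d : ℕ} {I Θ : Type*} [MeasurableSpace Θ]
    (D : I → Measure Θ) (ℓ : I → Param d → Θ → ℝ) (α : ℝ) (i : I) (w : Param d) : ℝ :=
  taskLoss D ℓ i (w - α • ∇ (taskLoss D ℓ i) w)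

/-- The meta-learning objective `F(w) = E_{i ∼ p} f_i(w - α ∇f_i(w))`. -/
def metaLoss {d : ℕ} {I Θ : Type*} [MeasurableSpace I] [MeasurableSpace Θ] (p : Measure I)
    (D : I → Measure Θ) (ℓ : I → Param d → Θ → ℝ) (α : ℝ) (w : Param d) : ℝ :=
  ∫ i, adaptedLoss D ℓ α i w ∂p

/-- The Hessian of `f` at `w` as a linear operator (compared in operator norm). -/
def hessian {d : ℕ} (f : Param d → ℝ) (w : Param d) : Param d →L[ℝ] Param d :=
  fderiv ℝ (fun u => ∇ f u) w

/-- The stochastic gradient `∇f_i(w, θ)`: the gradient in `w` of the sample loss. -/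
def sampleGrad {d : ℕ} {I Θ : Type*} (ℓ : I → Param d → Θ → ℝ) (i : I) (w : Param d) (θ : Θ) :
    Param d :=
  ∇ (fun u => ℓ i u θ) w

/-- The batch gradient: the average of `∇f_i(w, θ)` over a batch of `n` data points. -/
def batchGrad {d : ℕ} {I Θ : Type*} (ℓ : I → Param d → Θ → ℝ) {n : ℕ} (i : I) (w : Param d)
    (S : Fin n → Θ) : Param d :=
  (n : ℝ)⁻¹ • ∑ j, sampleGrad ℓ i w (S j)

/-- One task drawn for the meta update: a task with an inner and an outer data batch. -/
abbrev UpdateDraw (I Θ : Type*) (Din Do : ℕ) := I × (Fin Din → Θ) × (Fin Do → Θ)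

/-- One task drawn for the step size: a task with a data batch. -/
abbrev StepDraw (I Θ : Type*) (Dβ : ℕ) := I × (Fin Dβ → Θ)

/-- Everything drawn at one iteration: `B` tasks (with data) for the meta update and `B'` tasks
(with data) for the step size. -/
abbrev Draw (I Θ : Type*) (B Din Do B' Dβ : ℕ) :=
  (Fin B → UpdateDraw I Θ Din Do) × (Fin B' → StepDraw I Θ Dβ)

/-- The law of an `UpdateDraw`: the task `i` is drawn from `p`; given `i`, all points of the inner
and of the outer batch are independent draws from `D i`. -/
def updateLaw {I Θ : Type*} [MeasurableSpace I] [Countable I] [DiscreteMeasurableSpace I]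
    [MeasurableSpace Θ] (p : Measure I) (D : I → Measure Θ) (Din Do : ℕ) :
    Measure (UpdateDraw I Θ Din Do) :=
  p ⊗ₘ Kernel.ofFunOfCountable fun i =>
    (Measure.pi fun _ : Fin Din => D i).prod (Measure.pi fun _ : Fin Do => D i)

/-- The law of a `StepDraw`: the task `i` is drawn from `p`; given `i`, the points of the batch are
independent draws from `D i`. -/
def stepLaw {I Θ : Type*} [MeasurableSpace I] [Countable I] [DiscreteMeasurableSpace I]
    [MeasurableSpace Θ] (p : Measure I) (D : I → Measure Θ) (Dβ : ℕ) :
    Measure (StepDraw I Θ Dβ) :=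
  p ⊗ₘ Kernel.ofFunOfCountable fun i => Measure.pi fun _ : Fin Dβ => D i

/-- The law of everything drawn at one iteration: all `B + B'` task draws are independent. -/
def drawLaw {I Θ : Type*} [MeasurableSpace I] [Countable I] [DiscreteMeasurableSpace I]
    [MeasurableSpace Θ] (p : Measure I) (D : I → Measure Θ) (B Din Do B' Dβ : ℕ) :
    Measure (Draw I Θ B Din Do B' Dβ) :=
  (Measure.pi fun _ : Fin B => updateLaw p D Din Do).prod
    (Measure.pi fun _ : Fin B' => stepLaw p D Dβ)

/-- The stochastic step size parameter
`β̃(w) = 1 / (4 L + 2 ρ α (∑_{j ∈ B'} ‖∇̃f_j(w, D_β^j)‖) / B')`. -/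
def betaTilde {d : ℕ} {I Θ : Type*} (ℓ : I → Param d → Θ → ℝ) (L ρ α : ℝ) {B' Dβ : ℕ}
    (w : Param d) (T : Fin B' → StepDraw I Θ Dβ) : ℝ :=
  1 / (4 * L + 2 * ρ * α * (∑ j, ‖batchGrad ℓ (T j).1 w (T j).2‖) / B')

/-- One FO-MAML update with step size `β = β̃(w) / 18`:
`w - (β / B) ∑_{i ∈ B} ∇̃f_i(w - α ∇̃f_i(w, D_in^i), D_o^i)`. -/
def foStep {d : ℕ} {I Θ : Type*} (ℓ : I → Param d → Θ → ℝ) (L ρ α : ℝ) {B Din Do B' Dβ : ℕ}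
    (w : Param d) (s : Draw I Θ B Din Do B' Dβ) : Param d :=
  w - ((betaTilde ℓ L ρ α w s.2 / 18) / B) •
    ∑ b, batchGrad ℓ (s.1 b).1 (w - α • batchGrad ℓ (s.1 b).1 w (s.1 b).2.1) (s.1 b).2.2

/-- The FO-MAML iterates started at `w₀`, iteration `k` using the draws `S k`. -/
def iterate {d : ℕ} {I Θ Ω : Type*} (ℓ : I → Param d → Θ → ℝ) (L ρ α : ℝ) {B Din Do B' Dβ : ℕ}
    (S : ℕ → Ω → Draw I Θ B Din Do B' Dβ) (w₀ : Param d) : ℕ → Ω → Param d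
  | 0, _ => w₀
  | k + 1, ω => foStep ℓ L ρ α (iterate ℓ L ρ α S w₀ k ω) (S k ω)

end FOMAML

end

noncomputable section

set_option linter.unusedSectionVars false

namespace FOMAML

/-! ### Quadratic expansions and their averages. -/

section Calculus

variable {E : Type*} [NormedAddCommGroup E] [InnerProductSpace ℝ E]

/-! Write `x = ‖∇F(w)‖`, `N(w) = E‖∇f_i(w)‖`, `Λ(w) = 4L + 2ρα N(w)`, and `n` for the noise level
`noiseSq`. The proof is an expected-descent argument in which the smoothness constant of `F` depends
on the point.

Local smoothness: differentiating `f_i(w - α∇f_i(w))` produces a Hessian factor, whose variation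
costs a multiple of `ρα‖∇f_i(w)‖`. Hence `F` has at `w` a quadratic expansion with constant `0.55
Λ(w)` (`abs_metaLoss_sub_sub_inner_le`), and no uniform constant is available. Since `αL ≤ 1/10`,
the gradients of `F` and `f` are close and `N ≤ 1.27 (x + σ)`.

One step: given `w`, the averaged direction `G` and the step size are functions of independent
draws, so their moments factor. Dropping the Hessian biases `G` by only a small multiple of `x` plus
noise; thus `⟨∇F, E G⟩ ≥ 0.61 x² - 4n` and `E‖G‖² ≤ 2.7 x² + 14n`. The batch sizes for the step size
make `E β̃` comparable to `1/Λ(w)` and `E β̃²` of order `1/Λ(w)²`. Together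
(`integral_metaLoss_foStep_le`), `F` decreases in mean by at least `(x²/100 - n)/Λ(w)`.

Averaging over the iterate: `Λ(w) ≤ K L (1 + x)` turns the decrease into a multiple of `x²/(1 + x)`,
which is convex in `x`. Its tangent line at `M` shows that `E‖∇F(w_k)‖ ≥ M` forces a definite
decrease (`integral_metaLoss_iterateLaw_succ_le`).

Stopping: for `M = C₁√n + ε` the decrease is at least `(n + ε²/κ)/L`. As `F` is bounded below, the
first `k` with `E‖∇F(w_k)‖ ≤ M` satisfies `k (n + ε²/κ) ≤ LΔ`; dropping either summand on the left
gives one of the two entries of the minimum. -/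

theorem abs_sub_sub_inner_le_of_hasGradientAt [CompleteSpace E] {h : E → ℝ} {g : E → E} {K : ℝ}
    {w : E} (hg : ∀ u, HasGradientAt h (g u) u) (hK0 : 0 ≤ K)
    (hK : ∀ u, ‖g u - g w‖ ≤ K * ‖u - w‖) (u : E) :
    |h u - h w - inner ℝ (g w) (u - w)| ≤ K * ‖u - w‖ ^ 2 := by
  -- The mean value inequality on the segment, with the derivative at `w` subtracted. It gives `K`
  -- where integration would give `K/2`, and it compares gradients only with the one at `w`, as a
  -- constant depending on `w` requires.
  have key := Convex.norm_image_sub_le_of_norm_hasFDerivWithin_le' (𝕜 := ℝ) (f := h)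
    (f' := fun z => InnerProductSpace.toDual ℝ E (g z)) (φ := InnerProductSpace.toDual ℝ E (g w))
    (s := segment ℝ w u) (C := K * ‖u - w‖) (x := w) (y := u)
    (fun z _ => ((hg z).hasFDerivAt).hasFDerivWithinAt)
    (fun z hz => by
      rw [← map_sub, LinearIsometryEquiv.norm_map]
      refine (hK z).trans (mul_le_mul_of_nonneg_left ?_ hK0)
      obtain ⟨t, ht, rfl⟩ := (segment_eq_image' ℝ w u ▸ hz : z ∈ _)
      simp only [add_sub_cancel_left, norm_smul, Real.norm_eq_abs, abs_of_nonneg ht.1]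
      exact mul_le_of_le_one_left (norm_nonneg _) ht.2)
    (convex_segment w u) (left_mem_segment ℝ w u) (right_mem_segment ℝ w u)
  simp only [InnerProductSpace.toDual_apply_apply, Real.norm_eq_abs] at key
  calc _ ≤ _ := key
    _ = _ := by ring

/-- A quadratic remainder is `o(‖u - w‖)`. Combined with averaged expansions, this identifies the
gradients of `f` and `F` without a separate differentiation under the integral. -/
theorem hasGradientAt_of_abs_sub_sub_inner_le [CompleteSpace E] {h : E → ℝ} {g w : E} {K : ℝ}
    (hK : ∀ u, |h u - h w - inner ℝ g (u - w)| ≤ K * ‖u - w‖ ^ 2) : HasGradientAt h g w := by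
  rw [hasGradientAt_iff_isLittleO]
  have h1 : (fun u => h u - h w - inner ℝ g (u - w)) =O[nhds w] fun u => ‖u - w‖ ^ 2 :=
    Asymptotics.IsBigO.of_bound K (Filter.Eventually.of_forall fun u => by
      simpa [abs_of_nonneg] using hK u)
  refine h1.trans_isLittleO ?_
  have h2 : (fun x : E => ‖x - w‖ ^ 2) =o[nhds w] fun x => ‖x - w‖ :=
    (Asymptotics.isLittleO_pow_id (𝕜 := ℝ) one_lt_two).comp_tendsto (by
      have : Continuous fun x : E => ‖x - w‖ := by fun_prop
      simpa using this.tendsto w)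
  exact h2.of_norm_right

variable {I : Type*} [MeasurableSpace I] {p : Measure I}

theorem abs_integral_sub_sub_inner_le [CompleteSpace E] {h : I → E → ℝ} {g : I → E} {K : I → ℝ}
    {w u : E} (hw : Integrable (fun i => h i w) p) (hu : Integrable (fun i => h i u) p)
    (hg : Integrable g p) (hK : Integrable K p)
    (hb : ∀ i, |h i u - h i w - inner ℝ (g i) (u - w)| ≤ K i * ‖u - w‖ ^ 2) :
    |(∫ i, h i u ∂p) - (∫ i, h i w ∂p) - inner ℝ (∫ i, g i ∂p) (u - w)|
      ≤ (∫ i, K i ∂p) * ‖u - w‖ ^ 2 := by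
  have h3 : inner ℝ (∫ i, g i ∂p) (u - w) = ∫ i, inner ℝ (g i) (u - w) ∂p := by
    rw [real_inner_comm, ← integral_inner hg]
    simp_rw [real_inner_comm]
  have h4 : Integrable (fun i => h i u - h i w) p := hu.sub hw
  have h5 : Integrable (fun i => inner ℝ (g i) (u - w)) p := hg.inner_const _
  rw [h3, ← integral_sub hu hw, ← integral_sub h4 h5, ← integral_mul_const]
  exact abs_integral_le_integral_abs.trans (integral_mono (h4.sub h5).abs (hK.mul_const _) hb)

end Calculus

/-! ### Variance and sample means. -/

section Moments

variable {X : Type*} [MeasurableSpace X] {E : Type*} [NormedAddCommGroup E]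

theorem memLp_two_of_integrable_norm_sub_sq {ν : Measure X} [IsFiniteMeasure ν] {Y : X → E}
    {c : E} (hm : AEStronglyMeasurable Y ν) (h : Integrable (fun x => ‖Y x - c‖ ^ 2) ν) :
    MemLp Y 2 ν := by
  have h1 : MemLp (fun x => Y x - c) 2 ν :=
    (memLp_two_iff_integrable_sq_norm (hm.sub aestronglyMeasurable_const)).2 h
  have h2 := h1.add (memLp_const c)
  have h3 : ((fun x => Y x - c) + fun _ => c) = Y := by ext x; simp
  rwa [h3] at h2

theorem MemLp.integrable_norm_sub_sq {ν : Measure X} [IsFiniteMeasure ν] {Y : X → E}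
    (h : MemLp Y 2 ν) (c : E) : Integrable (fun x => ‖Y x - c‖ ^ 2) ν := by
  have h1 : MemLp (fun x => Y x - c) 2 ν := h.sub (memLp_const c)
  exact h1.integrable_norm_pow two_ne_zero

theorem integral_norm_sub_le_sqrt {ν : Measure X} [IsProbabilityMeasure ν] {Y : X → E}
    (h : MemLp Y 2 ν) (c : E) {V : ℝ} (hV : ∫ x, ‖Y x - c‖ ^ 2 ∂ν ≤ V ^ 2) (hV0 : 0 ≤ V) :
    ∫ x, ‖Y x - c‖ ∂ν ≤ V := by
  have h1 : Integrable (fun x => ‖Y x - c‖) ν :=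
    ((h.integrable one_le_two).sub (integrable_const c)).norm
  have h2 := MemLp.integrable_norm_sub_sq h c
  set m := ∫ x, ‖Y x - c‖ ∂ν
  have h0 : 0 ≤ m := integral_nonneg fun _ => norm_nonneg _
  -- Integrating `(‖Y - c‖ - m)² ≥ 0` gives `m² ≤ E‖Y - c‖²`.
  have h3 : ∫ x, (2 * m * ‖Y x - c‖ - m ^ 2) ∂ν ≤ ∫ x, ‖Y x - c‖ ^ 2 ∂ν := by
    refine integral_mono ((h1.const_mul _).sub (integrable_const _)) h2 fun x => ?_
    nlinarith [sq_nonneg (‖Y x - c‖ - m)]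
  rw [integral_sub (h1.const_mul _) (integrable_const _), integral_const_mul] at h3
  simp only [integral_const, probReal_univ, smul_eq_mul, one_mul] at h3
  exact abs_le_of_sq_le_sq' (by nlinarith) hV0 |>.2

variable [InnerProductSpace ℝ E]

/-- Bias-variance decomposition: the cross term vanishes because `Y` minus its mean integrates to
zero. -/
theorem integral_norm_sub_sq_eq [CompleteSpace E] {ν : Measure X} [IsProbabilityMeasure ν] {Y : X → E}
    (h : MemLp Y 2 ν) (c : E) :
    ∫ x, ‖Y x - c‖ ^ 2 ∂ν = ∫ x, ‖Y x - ∫ y, Y y ∂ν‖ ^ 2 ∂ν + ‖(∫ y, Y y ∂ν) - c‖ ^ 2 := by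
  have h1 := h.integrable one_le_two
  set m := ∫ y, Y y ∂ν
  have h2 := MemLp.integrable_norm_sub_sq h m
  have h4 : Integrable (fun x => inner ℝ (Y x - m) (m - c)) ν :=
    (h1.sub (integrable_const m)).inner_const _
  have h5 : ∫ x, inner ℝ (Y x - m) (m - c) ∂ν = 0 := by
    have := integral_inner (𝕜 := ℝ) (h1.sub (integrable_const m)) (m - c)
    simp_rw [real_inner_comm (m - c)]
    simp only [Pi.sub_apply] at this
    rw [this, integral_sub h1 (integrable_const m)]
    simp [m]
  have h6 : ∀ x, ‖Y x - c‖ ^ 2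
      = ‖Y x - m‖ ^ 2 + 2 * inner ℝ (Y x - m) (m - c) + ‖m - c‖ ^ 2 := fun x => by
    rw [← norm_add_sq_real]; congr 2; abel
  have h7 : Integrable (fun x => ‖Y x - m‖ ^ 2 + 2 * inner ℝ (Y x - m) (m - c)) ν :=
    h2.add (h4.const_mul 2)
  simp_rw [h6]
  rw [integral_add h7 (integrable_const _), integral_add h2 (h4.const_mul 2), integral_const_mul,
    h5]
  simp

theorem integral_norm_sub_integral_sq_le [CompleteSpace E] {ν : Measure X} [IsProbabilityMeasure ν] {Y : X → E}
    (h : MemLp Y 2 ν) (c : E) :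
    ∫ x, ‖Y x - ∫ y, Y y ∂ν‖ ^ 2 ∂ν ≤ ∫ x, ‖Y x - c‖ ^ 2 ∂ν := by
  rw [integral_norm_sub_sq_eq h c]; nlinarith [sq_nonneg ‖(∫ y, Y y ∂ν) - c‖]

theorem memLp_sampleMean {ν : Measure X} [IsProbabilityMeasure ν] {Y : X → E}
    (h : MemLp Y 2 ν) (n : ℕ) :
    MemLp (fun s : Fin n → X => (n : ℝ)⁻¹ • ∑ j, Y (s j)) 2 (Measure.pi fun _ => ν) := by
  have h1 : ∀ j : Fin n, MemLp (fun s : Fin n → X => Y (s j)) 2 (Measure.pi fun _ => ν) :=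
    fun j => h.comp_measurePreserving (measurePreserving_eval (fun _ : Fin n => ν) j)
  have h2 : MemLp (fun s : Fin n → X => ∑ j, Y (s j)) 2 (Measure.pi fun _ => ν) :=
    memLp_finsetSum _ fun j _ => h1 j
  exact h2.const_smul (n : ℝ)⁻¹

theorem integral_sampleMean {ν : Measure X} [IsProbabilityMeasure ν] {Y : X → E}
    (h : Integrable Y ν) {n : ℕ} (hn : 0 < n) :
    ∫ s : Fin n → X, (n : ℝ)⁻¹ • ∑ j, Y (s j) ∂(Measure.pi fun _ => ν) = ∫ x, Y x ∂ν := by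
  have h1 : ∀ j : Fin n, Integrable (fun s : Fin n → X => Y (s j)) (Measure.pi fun _ => ν) :=
    fun j => (measurePreserving_eval (fun _ : Fin n => ν) j).integrable_comp_of_integrable h
  have h2 : ∀ j : Fin n, ∫ s : Fin n → X, Y (s j) ∂(Measure.pi fun _ => ν) = ∫ x, Y x ∂ν :=
    fun j => by
      have hj := measurePreserving_eval (fun _ : Fin n => ν) j
      conv_rhs => rw [← hj.map_eq]
      rw [integral_map hj.measurable.aemeasurable (by rw [hj.map_eq]; exact h.1)]
  rw [integral_smul, integral_finsetSum _ fun j _ => h1 j]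
  simp_rw [h2]
  simp only [Finset.sum_const, Finset.card_univ, Fintype.card_fin, ← Nat.cast_smul_eq_nsmul ℝ,
    smul_smul]
  rw [inv_mul_cancel₀ (by positivity), one_smul]

/-- After centring and expanding the square, the off-diagonal inner products integrate to zero by
independence of the coordinates; the `n` diagonal terms remain, with weight `1/n²`. -/
theorem integral_norm_sampleMean_sub_sq [CompleteSpace E] [MeasurableSpace E] [BorelSpace E] {ν : Measure X}
    [IsProbabilityMeasure ν] {Y : X → E} (h : MemLp Y 2 ν) {n : ℕ} (hn : 0 < n) :
    ∫ s : Fin n → X, ‖(n : ℝ)⁻¹ • ∑ j, Y (s j) - ∫ x, Y x ∂ν‖ ^ 2 ∂(Measure.pi fun _ => ν)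
      = (∫ x, ‖Y x - ∫ y, Y y ∂ν‖ ^ 2 ∂ν) / n := by
  set m := ∫ x, Y x ∂ν with hm
  set π := Measure.pi fun _ : Fin n => ν
  have hZ : MemLp (fun x => Y x - m) 2 ν := h.sub (memLp_const m)
  set Z : X → E := fun x => Y x - m
  have hZm : ∫ x, Z x ∂ν = 0 := by
    simp only [Z]; rw [integral_sub (h.integrable one_le_two) (integrable_const m)]; simp [m]
  have hp : ∀ j, MeasurePreserving (fun s : Fin n → X => s j) π ν :=
    fun j => measurePreserving_eval (fun _ : Fin n => ν) j
  have hZj : ∀ j, MemLp (fun s : Fin n → X => Z (s j)) 2 π :=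
    fun j => hZ.comp_measurePreserving (hp j)
  have hsq : ∀ j, ∫ s : Fin n → X, ‖Z (s j)‖ ^ 2 ∂π = ∫ x, ‖Z x‖ ^ 2 ∂ν := by
    intro j
    conv_rhs => rw [← (hp j).map_eq]
    rw [integral_map (hp j).measurable.aemeasurable
      (by rw [(hp j).map_eq]; exact hZ.1.norm.pow 2)]
  have hone : ∀ j, ∫ s : Fin n → X, Z (s j) ∂π = 0 := by
    intro j
    rw [← hZm]
    conv_rhs => rw [← (hp j).map_eq]
    rw [integral_map (hp j).measurable.aemeasurable (by rw [(hp j).map_eq]; exact hZ.1)]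
  have hexp : ∀ s : Fin n → X, ‖(n : ℝ)⁻¹ • ∑ j, Y (s j) - m‖ ^ 2
      = ((n : ℝ)⁻¹) ^ 2 * ∑ j, ∑ k, inner ℝ (Z (s j)) (Z (s k)) := by
    intro s
    have : (n : ℝ)⁻¹ • ∑ j, Y (s j) - m = (n : ℝ)⁻¹ • ∑ j, Z (s j) := by
      simp only [Z, Finset.sum_sub_distrib, Finset.sum_const, Finset.card_univ, Fintype.card_fin,
        ← Nat.cast_smul_eq_nsmul ℝ, smul_sub, smul_smul]
      rw [inv_mul_cancel₀ (by positivity), one_smul]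
    rw [this, norm_smul, mul_pow, ← real_inner_self_eq_norm_sq (∑ j, Z (s j)), sum_inner]
    simp_rw [inner_sum]
    simp
  have hcross : ∀ j k, ∫ s : Fin n → X, inner ℝ (Z (s j)) (Z (s k)) ∂π
      = if j = k then ∫ x, ‖Z x‖ ^ 2 ∂ν else 0 := by
    intro j k
    split_ifs with hjk
    · subst hjk
      simp_rw [real_inner_self_eq_norm_sq]
      exact hsq j
    · have hind : (fun s : Fin n → X => Z (s j)) ⟂ᵢ[π] (fun s => Z (s k)) :=
        (iIndepFun_pi (X := fun _ : Fin n => Z) fun _ => hZ.1.aemeasurable).indepFun hjk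
      have h1 := hind.integral_bilin ((hZj j).integrable one_le_two) ((hZj k).integrable one_le_two)
        (innerSL ℝ)
      refine h1.trans ?_
      rw [hone j, map_zero]
      rfl
  simp_rw [hexp]
  have hi : ∀ j k, Integrable (fun s : Fin n → X => inner ℝ (Z (s j)) (Z (s k))) π :=
    fun j k => by
      refine ((hZj j).norm.integrable_mul (hZj k).norm).mono' ((hZj j).1.inner (hZj k).1)
        (Filter.Eventually.of_forall fun s => ?_)
      exact norm_inner_le_norm _ _
  rw [integral_const_mul, integral_finsetSum _ fun j _ => integrable_finsetSum _ fun k _ => hi j k]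
  rw [Finset.sum_congr rfl fun j _ => integral_finsetSum _ fun k _ => hi j k]
  simp_rw [hcross]
  simp only [Finset.sum_ite_eq, Finset.mem_univ, if_true, Finset.sum_const, Finset.card_univ,
    Fintype.card_fin, nsmul_eq_mul]
  change _ = (∫ x, ‖Z x‖ ^ 2 ∂ν) / n
  field_simp

theorem integral_norm_sampleMean_sub_sq_le [CompleteSpace E] [MeasurableSpace E] [BorelSpace E] {ν : Measure X}
    [IsProbabilityMeasure ν] {Y : X → E} (h : MemLp Y 2 ν) {n : ℕ} (hn : 0 < n) (c : E) :
    ∫ s : Fin n → X, ‖(n : ℝ)⁻¹ • ∑ j, Y (s j) - ∫ x, Y x ∂ν‖ ^ 2 ∂(Measure.pi fun _ => ν)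
      ≤ (∫ x, ‖Y x - c‖ ^ 2 ∂ν) / n := by
  rw [integral_norm_sampleMean_sub_sq h hn]
  exact div_le_div_of_nonneg_right (integral_norm_sub_integral_sq_le h c) (Nat.cast_nonneg n)

end Moments

/-! ### Integration over a task and then over its data. -/

section Disintegration

variable {X Y : Type*} [MeasurableSpace X] [MeasurableSpace Y]

theorem integrable_compProd_of_integral_norm_le [Countable X] [DiscreteMeasurableSpace X]
    {G : Type*} [NormedAddCommGroup G] {μ : Measure X}
    [IsFiniteMeasure μ] {κ : Kernel X Y} [IsMarkovKernel κ] {f : X × Y → G} {h : X → ℝ}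
    (hm : AEStronglyMeasurable f (μ ⊗ₘ κ)) (hf : ∀ x, Integrable (fun y => f (x, y)) (κ x))
    (hle : ∀ x, ∫ y, ‖f (x, y)‖ ∂(κ x) ≤ h x) (hh : Integrable h μ) : Integrable f (μ ⊗ₘ κ) := by
  rw [Measure.integrable_compProd_iff hm]
  refine ⟨Filter.Eventually.of_forall hf, hh.mono' (Measurable.of_discrete).aestronglyMeasurable ?_⟩
  refine Filter.Eventually.of_forall fun x => ?_
  rw [Real.norm_of_nonneg (integral_nonneg fun _ => norm_nonneg _)]
  exact hle x

theorem integral_compProd_le {μ : Measure X}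
    [IsFiniteMeasure μ] {κ : Kernel X Y} [IsMarkovKernel κ] {f : X × Y → ℝ} {h : X → ℝ}
    (hf : Integrable f (μ ⊗ₘ κ)) (hle : ∀ x, ∫ y, f (x, y) ∂(κ x) ≤ h x) (hh : Integrable h μ) :
    ∫ z, f z ∂(μ ⊗ₘ κ) ≤ ∫ x, h x ∂μ := by
  -- `μ ⊗ₘ κ` unfolds to a kernel product over `Unit`, to which integrability of the fibre integrals
  -- applies.
  have h1 : Integrable f ((Kernel.const Unit μ ⊗ₖ Kernel.prodMkLeft Unit κ) ()) := hf
  rw [Measure.integral_compProd hf]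
  exact integral_mono h1.integral_compProd hh hle

end Disintegration

end FOMAML

/-! ### The adapted loss of a single task. -/

namespace FOMAML

/-- The gradient of `u ↦ f (u - α ∇f u)`. -/
def adaptedGrad {d : ℕ} (f : Param d → ℝ) (α : ℝ) (w : Param d) : Param d :=
  (ContinuousLinearMap.adjoint (ContinuousLinearMap.id ℝ (Param d) - α • hessian f w))
    (∇ f (w - α • ∇ f w))

section Task

variable {d : ℕ} {f : Param d → ℝ} {L ρ α : ℝ}

theorem differentiable_gradient (hf : ContDiff ℝ 2 f) : Differentiable ℝ (∇ f) := by
  have h1 : Differentiable ℝ (fderiv ℝ f) :=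
    (hf.fderiv_right (m := 1) (by norm_num)).differentiable one_ne_zero
  exact (InnerProductSpace.toDual ℝ (Param d)).symm.toContinuousLinearEquiv.differentiable.comp h1

theorem hasGradientAt_gradient (hf : ContDiff ℝ 2 f) (w : Param d) : HasGradientAt f (∇ f w) w :=
  ((hf.differentiable two_ne_zero) w).hasGradientAt

theorem norm_hessian_le (hL0 : 0 ≤ L) (hL : ∀ w u, ‖∇ f w - ∇ f u‖ ≤ L * ‖w - u‖) (w : Param d) :
    ‖hessian f w‖ ≤ L := by
  have h : LipschitzWith (Real.toNNReal L) (∇ f) := LipschitzWith.of_dist_le_mul fun x y => by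
    rw [dist_eq_norm, dist_eq_norm, Real.coe_toNNReal L hL0]; exact hL x y
  have := norm_fderiv_le_of_lipschitz ℝ h (x₀ := w)
  rwa [Real.coe_toNNReal L hL0] at this

theorem norm_id_sub_hessian_le (hL0 : 0 ≤ L) (hL : ∀ w u, ‖∇ f w - ∇ f u‖ ≤ L * ‖w - u‖)
    (hα : 0 ≤ α) (hαL : α * L ≤ 1 / 10) (w : Param d) :
    ‖ContinuousLinearMap.id ℝ (Param d) - α • hessian f w‖ ≤ 11 / 10 := by
  refine (norm_sub_le _ _).trans ?_
  rw [norm_smul, Real.norm_of_nonneg hα]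
  have h1 := ContinuousLinearMap.norm_id_le (𝕜 := ℝ) (E := Param d)
  have h2 := mul_le_mul_of_nonneg_left (norm_hessian_le hL0 hL w) hα
  linarith

theorem norm_gradient_adapted_le (hL : ∀ w u, ‖∇ f w - ∇ f u‖ ≤ L * ‖w - u‖)
    (hα : 0 ≤ α) (hαL : α * L ≤ 1 / 10) (w : Param d) :
    ‖∇ f (w - α • ∇ f w) - ∇ f w‖ ≤ α * L * ‖∇ f w‖ ∧
      ‖∇ f (w - α • ∇ f w)‖ ≤ 11 / 10 * ‖∇ f w‖ := by
  have h1 := hL (w - α • ∇ f w) w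
  rw [sub_sub_cancel_left, norm_neg, norm_smul, Real.norm_of_nonneg hα] at h1
  have h2 : ‖∇ f (w - α • ∇ f w) - ∇ f w‖ ≤ α * L * ‖∇ f w‖ := by linarith
  refine ⟨h2, ?_⟩
  have h3 := norm_le_norm_sub_add (∇ f (w - α • ∇ f w)) (∇ f w)
  nlinarith [norm_nonneg (∇ f w)]

theorem norm_adaptedGrad_sub_gradient_adapted_le (hL0 : 0 ≤ L)
    (hL : ∀ w u, ‖∇ f w - ∇ f u‖ ≤ L * ‖w - u‖)
    (hα : 0 ≤ α) (hαL : α * L ≤ 1 / 10) (w : Param d) :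
    ‖adaptedGrad f α w - ∇ f (w - α • ∇ f w)‖ ≤ 11 / 10 * (α * L) * ‖∇ f w‖ := by
  have h1 : adaptedGrad f α w - ∇ f (w - α • ∇ f w)
      = -(α • (ContinuousLinearMap.adjoint (hessian f w)) (∇ f (w - α • ∇ f w))) := by
    simp only [adaptedGrad, map_sub, map_smulₛₗ, ContinuousLinearMap.adjoint_id,
      _root_.sub_apply, ContinuousLinearMap.id_apply, _root_.smul_apply]
    simp
  rw [h1, norm_neg, norm_smul, Real.norm_of_nonneg hα]
  have h2 := (ContinuousLinearMap.adjoint (hessian f w)).le_opNorm (∇ f (w - α • ∇ f w))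
  rw [LinearIsometryEquiv.norm_map] at h2
  have h3 := (norm_gradient_adapted_le hL hα hαL w).2
  calc _ ≤ α * (L * (11 / 10 * ‖∇ f w‖)) := by
        refine mul_le_mul_of_nonneg_left (h2.trans ?_) hα
        exact mul_le_mul (norm_hessian_le hL0 hL w) h3 (norm_nonneg _) hL0
    _ = _ := by ring

/-- Removing the Hessian factor costs `1.1 αL ‖∇f‖`, and moving the base point back to `w` costs `αL
‖∇f‖`; with `αL ≤ 1/10` the sum is `0.21 ‖∇f‖`. -/
theorem norm_adaptedGrad_sub_gradient_le (hL0 : 0 ≤ L)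
    (hL : ∀ w u, ‖∇ f w - ∇ f u‖ ≤ L * ‖w - u‖)
    (hα : 0 ≤ α) (hαL : α * L ≤ 1 / 10) (w : Param d) :
    ‖adaptedGrad f α w - ∇ f w‖ ≤ 21 / 100 * ‖∇ f w‖ := by
  have h1 := norm_adaptedGrad_sub_gradient_adapted_le hL0 hL hα hαL w
  have h2 := (norm_gradient_adapted_le hL hα hαL w).1
  have h3 := norm_sub_le_norm_sub_add_norm_sub (adaptedGrad f α w) (∇ f (w - α • ∇ f w)) (∇ f w)
  nlinarith [norm_nonneg (∇ f w)]

/-- Chain rule. The adjoint comes from representing the composed functional by a vector, so symmetry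
of the Hessian is not needed. -/
theorem hasGradientAt_adapted (hf : ContDiff ℝ 2 f) (w : Param d) :
    HasGradientAt (fun u => f (u - α • ∇ f u)) (adaptedGrad f α w) w := by
  have h1 : HasFDerivAt (fun u => u - α • ∇ f u)
      (ContinuousLinearMap.id ℝ (Param d) - α • hessian f w) w :=
    (hasFDerivAt_id w).sub (((differentiable_gradient hf) w).hasFDerivAt.const_smul α)
  have h2 := (hasGradientAt_gradient hf (w - α • ∇ f w)).hasFDerivAt.comp w h1
  have h3 : InnerProductSpace.toDual ℝ (Param d) (adaptedGrad f α w)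
      = (InnerProductSpace.toDual ℝ (Param d) (∇ f (w - α • ∇ f w))).comp
        (ContinuousLinearMap.id ℝ (Param d) - α • hessian f w) := by
    ext v
    rw [InnerProductSpace.toDual_apply_apply, adaptedGrad, ContinuousLinearMap.adjoint_inner_left]
    rfl
  rw [hasGradientAt_iff_hasFDerivAt, h3]
  exact h2

/-- With `A = id - αH` and `v` the gradient at the adapted point, the difference is `A_u*(v_u - v_w)
+ (A_u - A_w)* v_w`. The first term costs `1.1² L ≤ 2L`, the second `αρ · 1.1‖∇f(w)‖`. Splitting in
this order leaves a constant that depends on `w` but not on `u`. -/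
theorem norm_adaptedGrad_sub_le (hL0 : 0 ≤ L) (hL : ∀ w u, ‖∇ f w - ∇ f u‖ ≤ L * ‖w - u‖)
    (hρ : ∀ w u, ‖hessian f w - hessian f u‖ ≤ ρ * ‖w - u‖) (hρ0 : 0 ≤ ρ)
    (hα : 0 ≤ α) (hαL : α * L ≤ 1 / 10) (w u : Param d) :
    ‖adaptedGrad f α u - adaptedGrad f α w‖
      ≤ (2 * L + 11 / 10 * (ρ * α) * ‖∇ f w‖) * ‖u - w‖ := by
  set A := fun z => ContinuousLinearMap.id ℝ (Param d) - α • hessian f z with hA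
  have h1 : adaptedGrad f α u - adaptedGrad f α w
      = (ContinuousLinearMap.adjoint (A u)) (∇ f (u - α • ∇ f u) - ∇ f (w - α • ∇ f w))
        + (ContinuousLinearMap.adjoint (A u - A w)) (∇ f (w - α • ∇ f w)) := by
    simp only [adaptedGrad, map_sub, _root_.sub_apply, hA]
    abel
  have h2 : ‖(u - α • ∇ f u) - (w - α • ∇ f w)‖ ≤ 11 / 10 * ‖u - w‖ := by
    have : (u - α • ∇ f u) - (w - α • ∇ f w) = (u - w) - α • (∇ f u - ∇ f w) := by
      rw [smul_sub]; abel
    rw [this]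
    refine (norm_sub_le _ _).trans ?_
    rw [norm_smul, Real.norm_of_nonneg hα]
    have := mul_le_mul_of_nonneg_left (hL u w) hα
    nlinarith [norm_nonneg (u - w)]
  have h3 := hL (u - α • ∇ f u) (w - α • ∇ f w)
  have h4 : ‖∇ f (u - α • ∇ f u) - ∇ f (w - α • ∇ f w)‖ ≤ L * (11 / 10 * ‖u - w‖) :=
    h3.trans (mul_le_mul_of_nonneg_left h2 hL0)
  have h5 : ‖A u - A w‖ ≤ α * (ρ * ‖u - w‖) := by
    have : A u - A w = -(α • (hessian f u - hessian f w)) := by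
      simp only [hA, smul_sub]; abel
    rw [this, norm_neg, norm_smul, Real.norm_of_nonneg hα]
    exact mul_le_mul_of_nonneg_left (hρ u w) hα
  have h6 := (norm_gradient_adapted_le hL hα hαL w).2
  have h7 : ‖(ContinuousLinearMap.adjoint (A u))
      (∇ f (u - α • ∇ f u) - ∇ f (w - α • ∇ f w))‖ ≤ 11 / 10 * (L * (11 / 10 * ‖u - w‖)) := by
    refine (ContinuousLinearMap.le_opNorm _ _).trans ?_
    rw [LinearIsometryEquiv.norm_map]
    exact mul_le_mul (norm_id_sub_hessian_le hL0 hL hα hαL u) h4 (norm_nonneg _) (by norm_num)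
  have h8 : ‖(ContinuousLinearMap.adjoint (A u - A w)) (∇ f (w - α • ∇ f w))‖
      ≤ α * (ρ * ‖u - w‖) * (11 / 10 * ‖∇ f w‖) := by
    refine (ContinuousLinearMap.le_opNorm _ _).trans ?_
    rw [LinearIsometryEquiv.norm_map]
    exact mul_le_mul h5 h6 (norm_nonneg _) (by positivity)
  rw [h1]
  refine (norm_add_le _ _).trans ((add_le_add h7 h8).trans ?_)
  have := mul_nonneg hL0 (norm_nonneg (u - w))
  nlinarith

theorem abs_adapted_sub_sub_inner_le (hf : ContDiff ℝ 2 f) (hL0 : 0 ≤ L)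
    (hL : ∀ w u, ‖∇ f w - ∇ f u‖ ≤ L * ‖w - u‖)
    (hρ : ∀ w u, ‖hessian f w - hessian f u‖ ≤ ρ * ‖w - u‖) (hρ0 : 0 ≤ ρ)
    (hα : 0 ≤ α) (hαL : α * L ≤ 1 / 10) (w u : Param d) :
    |f (u - α • ∇ f u) - f (w - α • ∇ f w) - inner ℝ (adaptedGrad f α w) (u - w)|
      ≤ (2 * L + 11 / 10 * (ρ * α) * ‖∇ f w‖) * ‖u - w‖ ^ 2 :=
  abs_sub_sub_inner_le_of_hasGradientAt (h := fun u => f (u - α • ∇ f u))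
    (fun u => hasGradientAt_adapted hf u) (by positivity)
    (fun u => norm_adaptedGrad_sub_le hL0 hL hρ hρ0 hα hαL w u) u

end Task

end FOMAML

/-! ### Local smoothness of the meta-objective and comparison of gradients. -/

namespace FOMAML

/-- The standing assumptions on the task distribution, the losses and the parameters. -/
structure Assumptions {d : ℕ} {I Θ : Type*} [MeasurableSpace I] [MeasurableSpace Θ]
    (p : Measure I) (D : I → Measure Θ) (ℓ : I → Param d → Θ → ℝ) (L ρ σ σt α : ℝ) : Prop where
  measurable_loss : ∀ i w, Measurable (ℓ i w)
  differentiable_loss : ∀ i θ, Differentiable ℝ (fun w => ℓ i w θ)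
  integrable_taskLoss : ∀ w, Integrable (fun i => taskLoss D ℓ i w) p
  L_pos : 0 < L
  rho_nonneg : 0 ≤ ρ
  sigma_nonneg : 0 ≤ σ
  sigmat_nonneg : 0 ≤ σt
  alpha_nonneg : 0 ≤ α
  alpha_mul_le : α * L ≤ 1 / 10
  contDiff : ∀ i, ContDiff ℝ 2 (taskLoss D ℓ i)
  smooth : ∀ i w u, ‖∇ (taskLoss D ℓ i) w - ∇ (taskLoss D ℓ i) u‖ ≤ L * ‖w - u‖
  hessian_lipschitz : ∀ i w u,
    ‖hessian (taskLoss D ℓ i) w - hessian (taskLoss D ℓ i) u‖ ≤ ρ * ‖w - u‖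
  integrable_task_variance : ∀ w,
    Integrable (fun i => ‖∇ (meanLoss p D ℓ) w - ∇ (taskLoss D ℓ i) w‖ ^ 2) p
  task_variance_le : ∀ w, ∫ i, ‖∇ (meanLoss p D ℓ) w - ∇ (taskLoss D ℓ i) w‖ ^ 2 ∂p ≤ σ ^ 2
  unbiased : ∀ i w, ∫ θ, sampleGrad ℓ i w θ ∂(D i) = ∇ (taskLoss D ℓ i) w
  integrable_sample_variance : ∀ i w,
    Integrable (fun θ => ‖sampleGrad ℓ i w θ - ∇ (taskLoss D ℓ i) w‖ ^ 2) (D i)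
  sample_variance_le : ∀ i w,
    ∫ θ, ‖sampleGrad ℓ i w θ - ∇ (taskLoss D ℓ i) w‖ ^ 2 ∂(D i) ≤ σt ^ 2

/-- The mean norm `E_{i ∼ p} ‖∇f_i(w)‖` of the task gradients. -/
def meanGradNorm {d : ℕ} {I Θ : Type*} [MeasurableSpace I] [MeasurableSpace Θ]
    (p : Measure I) (D : I → Measure Θ) (ℓ : I → Param d → Θ → ℝ) (w : Param d) : ℝ :=
  ∫ i, ‖∇ (taskLoss D ℓ i) w‖ ∂p

/-- The local smoothness parameter `4 L + 2 ρ α E_{i ∼ p} ‖∇f_i(w)‖` of the meta-objective. -/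
def localSmoothness {d : ℕ} {I Θ : Type*} [MeasurableSpace I] [MeasurableSpace Θ]
    (p : Measure I) (D : I → Measure Θ) (ℓ : I → Param d → Θ → ℝ) (L ρ α : ℝ) (w : Param d) : ℝ :=
  4 * L + 2 * (ρ * α) * meanGradNorm p D ℓ w

namespace Assumptions

variable {d : ℕ} {I Θ : Type*} [MeasurableSpace I] [Countable I] [DiscreteMeasurableSpace I]
  [MeasurableSpace Θ] {p : Measure I} [IsProbabilityMeasure p] {D : I → Measure Θ}
  {ℓ : I → Param d → Θ → ℝ} {L ρ σ σt α : ℝ}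

theorem memLp_taskGrad (H : Assumptions p D ℓ L ρ σ σt α) (w : Param d) :
    MemLp (fun i => ∇ (taskLoss D ℓ i) w) 2 p :=
  memLp_two_of_integrable_norm_sub_sq (c := ∇ (meanLoss p D ℓ) w)
    (Measurable.of_discrete).aestronglyMeasurable (by
      simp_rw [norm_sub_rev _ (∇ (meanLoss p D ℓ) w)]; exact H.integrable_task_variance w)

theorem integrable_taskGrad (H : Assumptions p D ℓ L ρ σ σt α) (w : Param d) :
    Integrable (fun i => ∇ (taskLoss D ℓ i) w) p :=
  (H.memLp_taskGrad w).integrable one_le_two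

theorem abs_taskLoss_sub_sub_inner_le (H : Assumptions p D ℓ L ρ σ σt α) (i : I) (w u : Param d) :
    |taskLoss D ℓ i u - taskLoss D ℓ i w - inner ℝ (∇ (taskLoss D ℓ i) w) (u - w)|
      ≤ L * ‖u - w‖ ^ 2 :=
  abs_sub_sub_inner_le_of_hasGradientAt (fun u => hasGradientAt_gradient (H.contDiff i) u)
    H.L_pos.le (fun u => H.smooth i u w) u

theorem gradient_meanLoss (H : Assumptions p D ℓ L ρ σ σt α) (w : Param d) :
    ∇ (meanLoss p D ℓ) w = ∫ i, ∇ (taskLoss D ℓ i) w ∂p := by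
  refine (hasGradientAt_of_abs_sub_sub_inner_le (K := L) fun u => ?_).gradient
  have := abs_integral_sub_sub_inner_le (p := p) (h := fun i w => taskLoss D ℓ i w)
    (K := fun _ => L) (H.integrable_taskLoss w) (H.integrable_taskLoss u)
    (H.integrable_taskGrad w) (integrable_const L)
    (fun i => H.abs_taskLoss_sub_sub_inner_le i w u)
  simpa [meanLoss] using this

/-- By the quadratic expansion of `f_i`, adaptation changes the loss by at most `(α +
Lα²)‖∇f_i(w)‖²`, which is integrable because the task gradients have finite variance. -/
theorem integrable_adaptedLoss (H : Assumptions p D ℓ L ρ σ σt α) (w : Param d) :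
    Integrable (fun i => adaptedLoss D ℓ α i w) p := by
  have h1 : Integrable (fun i => ‖∇ (taskLoss D ℓ i) w‖ ^ 2) p :=
    (H.memLp_taskGrad w).integrable_norm_pow two_ne_zero
  have h2 : Integrable (fun i => adaptedLoss D ℓ α i w - taskLoss D ℓ i w) p := by
    refine (h1.const_mul (α + L * α ^ 2)).mono' (Measurable.of_discrete).aestronglyMeasurable
      (Filter.Eventually.of_forall fun i => ?_)
    have h3 := H.abs_taskLoss_sub_sub_inner_le i w (w - α • ∇ (taskLoss D ℓ i) w)
    rw [sub_sub_cancel_left, inner_neg_right, inner_smul_right, real_inner_self_eq_norm_sq,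
      norm_neg, norm_smul, Real.norm_of_nonneg H.alpha_nonneg, abs_le] at h3
    rw [Real.norm_eq_abs, abs_le, adaptedLoss]
    have := mul_nonneg H.alpha_nonneg (sq_nonneg ‖∇ (taskLoss D ℓ i) w‖)
    constructor <;> nlinarith
  refine (h2.add (H.integrable_taskLoss w)).congr (Filter.Eventually.of_forall fun i => ?_)
  simp

theorem integrable_adaptedGrad (H : Assumptions p D ℓ L ρ σ σt α) (w : Param d) :
    Integrable (fun i => adaptedGrad (taskLoss D ℓ i) α w) p := by
  refine ((H.integrable_taskGrad w).norm.const_mul (121 / 100)).mono'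
    (Measurable.of_discrete).aestronglyMeasurable (Filter.Eventually.of_forall fun i => ?_)
  have h1 := norm_adaptedGrad_sub_gradient_le H.L_pos.le (H.smooth i) H.alpha_nonneg
    H.alpha_mul_le w
  have h2 := norm_le_norm_sub_add (adaptedGrad (taskLoss D ℓ i) α w) (∇ (taskLoss D ℓ i) w)
  linarith

theorem abs_metaLoss_sub_sub_inner_integral_le (H : Assumptions p D ℓ L ρ σ σt α)
    (w u : Param d) :
    |metaLoss p D ℓ α u - metaLoss p D ℓ α w
        - inner ℝ (∫ i, adaptedGrad (taskLoss D ℓ i) α w ∂p) (u - w)|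
      ≤ (2 * L + 11 / 10 * (ρ * α) * meanGradNorm p D ℓ w) * ‖u - w‖ ^ 2 := by
  have hK : Integrable (fun i => 2 * L + 11 / 10 * (ρ * α) * ‖∇ (taskLoss D ℓ i) w‖) p :=
    (integrable_const _).add ((H.integrable_taskGrad w).norm.const_mul _)
  have := abs_integral_sub_sub_inner_le (h := adaptedLoss D ℓ α)
    (H.integrable_adaptedLoss w) (H.integrable_adaptedLoss u) (H.integrable_adaptedGrad w) hK
    (fun i => abs_adapted_sub_sub_inner_le (H.contDiff i) H.L_pos.le (H.smooth i)
      (H.hessian_lipschitz i) H.rho_nonneg H.alpha_nonneg H.alpha_mul_le w u)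
  rw [integral_add (integrable_const _) ((H.integrable_taskGrad w).norm.const_mul _),
    integral_const_mul (11 / 10 * (ρ * α))] at this
  simpa [metaLoss, meanGradNorm] using this

theorem hasGradientAt_metaLoss (H : Assumptions p D ℓ L ρ σ σt α) (w : Param d) :
    HasGradientAt (metaLoss p D ℓ α) (∫ i, adaptedGrad (taskLoss D ℓ i) α w ∂p) w :=
  hasGradientAt_of_abs_sub_sub_inner_le (H.abs_metaLoss_sub_sub_inner_integral_le w)

theorem gradient_metaLoss (H : Assumptions p D ℓ L ρ σ σt α) (w : Param d) :
    ∇ (metaLoss p D ℓ α) w = ∫ i, adaptedGrad (taskLoss D ℓ i) α w ∂p :=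
  (H.hasGradientAt_metaLoss w).gradient

theorem meanGradNorm_nonneg (w : Param d) : 0 ≤ meanGradNorm p D ℓ w :=
  integral_nonneg fun _ => norm_nonneg _

theorem four_mul_le_localSmoothness (H : Assumptions p D ℓ L ρ σ σt α) (w : Param d) :
    4 * L ≤ localSmoothness p D ℓ L ρ α w := by
  have := mul_nonneg (mul_nonneg H.rho_nonneg H.alpha_nonneg)
    (meanGradNorm_nonneg (p := p) (D := D) (ℓ := ℓ) w)
  rw [localSmoothness]; linarith

theorem localSmoothness_pos (H : Assumptions p D ℓ L ρ σ σt α) (w : Param d) :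
    0 < localSmoothness p D ℓ L ρ α w := by
  linarith [H.four_mul_le_localSmoothness w, H.L_pos]

theorem le_localSmoothness (H : Assumptions p D ℓ L ρ σ σt α) (w : Param d) :
    2 * L + 11 / 10 * (ρ * α) * meanGradNorm p D ℓ w
      ≤ 55 / 100 * localSmoothness p D ℓ L ρ α w := by
  rw [localSmoothness]; nlinarith [H.L_pos]

theorem abs_metaLoss_sub_sub_inner_le (H : Assumptions p D ℓ L ρ σ σt α) (w u : Param d) :
    |metaLoss p D ℓ α u - metaLoss p D ℓ α w - inner ℝ (∇ (metaLoss p D ℓ α) w) (u - w)|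
      ≤ 55 / 100 * localSmoothness p D ℓ L ρ α w * ‖u - w‖ ^ 2 := by
  rw [H.gradient_metaLoss]
  exact (H.abs_metaLoss_sub_sub_inner_integral_le w u).trans
    (mul_le_mul_of_nonneg_right (H.le_localSmoothness w) (sq_nonneg _))

theorem norm_gradient_metaLoss_sub_le (H : Assumptions p D ℓ L ρ σ σt α) (w u : Param d) :
    ‖∇ (metaLoss p D ℓ α) u - ∇ (metaLoss p D ℓ α) w‖
      ≤ 55 / 100 * localSmoothness p D ℓ L ρ α w * ‖u - w‖ := by
  rw [H.gradient_metaLoss, H.gradient_metaLoss,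
    ← integral_sub (H.integrable_adaptedGrad u) (H.integrable_adaptedGrad w)]
  have hN := (H.integrable_taskGrad w).norm.const_mul (11 / 10 * (ρ * α))
  have hK : Integrable (fun i => 2 * L + 11 / 10 * (ρ * α) * ‖∇ (taskLoss D ℓ i) w‖) p :=
    (integrable_const _).add hN
  refine (norm_integral_le_of_norm_le (hK.mul_const ‖u - w‖) (Filter.Eventually.of_forall fun i =>
    norm_adaptedGrad_sub_le H.L_pos.le (H.smooth i) (H.hessian_lipschitz i) H.rho_nonneg
      H.alpha_nonneg H.alpha_mul_le w u)).trans ?_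
  rw [integral_mul_const, integral_add (integrable_const _) hN,
    integral_const_mul (11 / 10 * (ρ * α))]
  refine mul_le_mul_of_nonneg_right ?_ (norm_nonneg _)
  simpa [meanGradNorm] using H.le_localSmoothness w

theorem continuous_gradient_metaLoss (H : Assumptions p D ℓ L ρ σ σt α) :
    Continuous (∇ (metaLoss p D ℓ α)) := by
  refine continuous_iff_continuousAt.2 fun w => ?_
  rw [ContinuousAt, tendsto_iff_norm_sub_tendsto_zero]
  refine squeeze_zero (fun _ => norm_nonneg _) (H.norm_gradient_metaLoss_sub_le w) ?_
  have : Continuous fun u => 55 / 100 * localSmoothness p D ℓ L ρ α w * ‖u - w‖ := by fun_prop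
  simpa using this.tendsto w

theorem integral_norm_gradient_sub_le (H : Assumptions p D ℓ L ρ σ σt α) (w : Param d) :
    ∫ i, ‖∇ (taskLoss D ℓ i) w - ∇ (meanLoss p D ℓ) w‖ ^ 2 ∂p ≤ σ ^ 2 := by
  simp_rw [norm_sub_rev _ (∇ (meanLoss p D ℓ) w)]
  exact H.task_variance_le w

theorem meanGradNorm_le_add (H : Assumptions p D ℓ L ρ σ σt α) (w : Param d) :
    meanGradNorm p D ℓ w ≤ ‖∇ (meanLoss p D ℓ) w‖ + σ := by
  have h1 := integral_norm_sub_le_sqrt (H.memLp_taskGrad w) _ (H.integral_norm_gradient_sub_le w)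
    H.sigma_nonneg
  have h2 : Integrable (fun i => ∇ (taskLoss D ℓ i) w - ∇ (meanLoss p D ℓ) w) p :=
    (H.integrable_taskGrad w).sub (integrable_const _)
  have h3 : meanGradNorm p D ℓ w
      ≤ ∫ i, (‖∇ (taskLoss D ℓ i) w - ∇ (meanLoss p D ℓ) w‖ + ‖∇ (meanLoss p D ℓ) w‖) ∂p :=
    integral_mono (H.integrable_taskGrad w).norm (h2.norm.add (integrable_const _))
      fun i => norm_le_norm_sub_add _ _
  rw [integral_add h2.norm (integrable_const _)] at h3
  simp only [integral_const, probReal_univ, smul_eq_mul, one_mul] at h3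
  linarith

theorem norm_gradient_metaLoss_sub_meanLoss_le (H : Assumptions p D ℓ L ρ σ σt α) (w : Param d) :
    ‖∇ (metaLoss p D ℓ α) w - ∇ (meanLoss p D ℓ) w‖ ≤ 21 / 100 * meanGradNorm p D ℓ w := by
  rw [H.gradient_metaLoss, H.gradient_meanLoss,
    ← integral_sub (H.integrable_adaptedGrad w) (H.integrable_taskGrad w), meanGradNorm,
    ← integral_const_mul]
  exact norm_integral_le_of_norm_le ((H.integrable_taskGrad w).norm.const_mul _)
    (Filter.Eventually.of_forall fun i => norm_adaptedGrad_sub_gradient_le H.L_pos.le (H.smooth i)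
      H.alpha_nonneg H.alpha_mul_le w)

/-- From `N ≤ ‖∇f‖ + σ ≤ ‖∇F‖ + 0.21 N + σ`, absorbing `0.21 N` on the left gives the factor `1/0.79
≤ 1.27`. -/
theorem meanGradNorm_le (H : Assumptions p D ℓ L ρ σ σt α) (w : Param d) :
    meanGradNorm p D ℓ w ≤ 127 / 100 * (‖∇ (metaLoss p D ℓ α) w‖ + σ) := by
  have h1 := H.meanGradNorm_le_add w
  have h2 := H.norm_gradient_metaLoss_sub_meanLoss_le w
  have h3 := norm_sub_norm_le (∇ (meanLoss p D ℓ) w) (∇ (metaLoss p D ℓ α) w)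
  rw [norm_sub_rev] at h3
  nlinarith [norm_nonneg (∇ (metaLoss p D ℓ α) w), H.sigma_nonneg]

theorem norm_gradient_meanLoss_le (H : Assumptions p D ℓ L ρ σ σt α) (w : Param d) :
    ‖∇ (meanLoss p D ℓ) w‖ ≤ 127 / 100 * ‖∇ (metaLoss p D ℓ α) w‖ + 27 / 100 * σ := by
  have h1 := H.meanGradNorm_le w
  have h2 := H.norm_gradient_metaLoss_sub_meanLoss_le w
  have h3 := norm_sub_norm_le (∇ (meanLoss p D ℓ) w) (∇ (metaLoss p D ℓ α) w)
  rw [norm_sub_rev] at h3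
  nlinarith [norm_nonneg (∇ (metaLoss p D ℓ α) w), H.sigma_nonneg]

theorem integral_norm_taskGrad_sq_le (H : Assumptions p D ℓ L ρ σ σt α) (w : Param d) :
    ∫ i, ‖∇ (taskLoss D ℓ i) w‖ ^ 2 ∂p ≤ ‖∇ (meanLoss p D ℓ) w‖ ^ 2 + σ ^ 2 := by
  have h1 := integral_norm_sub_sq_eq (H.memLp_taskGrad w) 0
  have h2 := H.integral_norm_gradient_sub_le w
  rw [← H.gradient_meanLoss] at h1
  simp only [sub_zero] at h1
  linarith

end Assumptions

end FOMAML

/-! ### Measurability of gradients and moments of batch gradients. -/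

namespace FOMAML

section Measurability

variable {d : ℕ} {Θ : Type*} [MeasurableSpace Θ]

/-- Continuity in `w` and measurability in `θ` make `h` jointly measurable. Directional derivatives
are then limits of the measurable quotients `n (h(w + v/n) - h(w))`, and the gradient is assembled
in an orthonormal basis. -/
theorem measurable_uncurry_gradient {h : Param d → Θ → ℝ} (hm : ∀ w, Measurable (h w))
    (hd : ∀ θ, Differentiable ℝ fun w => h w θ) :
    Measurable fun z : Param d × Θ => ∇ (fun u => h u z.2) z.1 := by
  have hj : Measurable (Function.uncurry h) :=
    measurable_uncurry_of_continuous_of_measurable (fun θ => (hd θ).continuous) hm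
  set b := EuclideanSpace.basisFun (Fin d) ℝ
  have h1 : ∀ v : Param d,
      Measurable fun z : Param d × Θ => fderiv ℝ (fun u => h u z.2) z.1 v := by
    intro v
    refine measurable_of_tendsto_metrizable (f := fun (n : ℕ) (z : Param d × Θ) =>
      (n : ℝ) • (h (z.1 + (n : ℝ)⁻¹ • v) z.2 - h z.1 z.2)) (fun n => ?_) ?_
    · have h2 : Measurable fun z : Param d × Θ => (z.1 + (n : ℝ)⁻¹ • v, z.2) :=
        (measurable_fst.add_const _).prodMk measurable_snd
      exact ((hj.comp h2).sub hj).const_smul (n : ℝ)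
    · refine tendsto_pi_nhds.2 fun z => ?_
      refine ((hd z.2) z.1).hasFDerivAt.lim v (c := fun n : ℕ => (n : ℝ)) (l := Filter.atTop) ?_
      simpa using tendsto_natCast_atTop_atTop (R := ℝ)
  have h3 : (fun z : Param d × Θ => ∇ (fun u => h u z.2) z.1)
      = fun z => ∑ j, fderiv ℝ (fun u => h u z.2) z.1 (b j) • b j := by
    ext1 z
    conv_lhs => rw [← b.sum_repr' (∇ (fun u => h u z.2) z.1)]
    refine Finset.sum_congr rfl fun j _ => ?_
    rw [real_inner_comm, gradient, InnerProductSpace.toDual_symm_apply]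
  rw [h3]
  exact Finset.measurable_fun_sum _ fun j _ => (h1 (b j)).smul_const _

end Measurability

section Product

variable {X Y : Type*} [MeasurableSpace X] [MeasurableSpace Y]

theorem integrable_prod_of_integral_norm_le {G : Type*} [NormedAddCommGroup G] {μ : Measure X}
    {ν : Measure Y} [SFinite ν] {f : X × Y → G} {h : X → ℝ}
    (hm : AEStronglyMeasurable f (μ.prod ν)) (hf : ∀ x, Integrable (fun y => f (x, y)) ν)
    (hle : ∀ x, ∫ y, ‖f (x, y)‖ ∂ν ≤ h x) (hh : Integrable h μ) : Integrable f (μ.prod ν) := by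
  rw [integrable_prod_iff hm]
  refine ⟨Filter.Eventually.of_forall hf, hh.mono' hm.norm.integral_prod_right' ?_⟩
  refine Filter.Eventually.of_forall fun x => ?_
  rw [Real.norm_of_nonneg (integral_nonneg fun _ => norm_nonneg _)]
  exact hle x

theorem integral_prod_le {μ : Measure X} [SFinite μ]
    {ν : Measure Y} [SFinite ν] {f : X × Y → ℝ} {h : X → ℝ}
    (hf : Integrable f (μ.prod ν)) (hle : ∀ x, ∫ y, f (x, y) ∂ν ≤ h x) (hh : Integrable h μ) :
    ∫ z, f z ∂(μ.prod ν) ≤ ∫ x, h x ∂μ := by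
  rw [integral_prod _ hf]
  exact integral_mono hf.integral_prod_left hh hle

end Product

namespace Assumptions

variable {d : ℕ} {I Θ : Type*} [MeasurableSpace I] [Countable I] [DiscreteMeasurableSpace I]
  [MeasurableSpace Θ] {p : Measure I} [IsProbabilityMeasure p] {D : I → Measure Θ}
  [∀ i, IsProbabilityMeasure (D i)]
  {ℓ : I → Param d → Θ → ℝ} {L ρ σ σt α : ℝ}

theorem measurable_sampleGrad (H : Assumptions p D ℓ L ρ σ σt α) {X : Type*} [MeasurableSpace X]
    {i : X → I} {w : X → Param d} {θ : X → Θ} (hi : Measurable i) (hw : Measurable w)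
    (hθ : Measurable θ) : Measurable fun x => sampleGrad ℓ (i x) (w x) (θ x) := by
  have h1 : Measurable fun z : I × (Param d × Θ) => sampleGrad ℓ z.1 z.2.1 z.2.2 :=
    measurable_from_prod_countable_right fun i =>
      measurable_uncurry_gradient (H.measurable_loss i) (H.differentiable_loss i)
  exact h1.comp (hi.prodMk (hw.prodMk hθ))

theorem measurable_batchGrad (H : Assumptions p D ℓ L ρ σ σt α) {X : Type*} [MeasurableSpace X]
    {n : ℕ} {i : X → I} {w : X → Param d} {S : X → Fin n → Θ} (hi : Measurable i)
    (hw : Measurable w) (hS : Measurable S) :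
    Measurable fun x => batchGrad ℓ (i x) (w x) (S x) :=
  (Finset.measurable_fun_sum _ fun j _ =>
    H.measurable_sampleGrad hi hw ((measurable_pi_apply j).comp hS)).const_smul (n : ℝ)⁻¹

theorem memLp_sampleGrad (H : Assumptions p D ℓ L ρ σ σt α) (i : I) (w : Param d) :
    MemLp (sampleGrad ℓ i w) 2 (D i) :=
  memLp_two_of_integrable_norm_sub_sq
    (H.measurable_sampleGrad measurable_const measurable_const measurable_id).aestronglyMeasurable
    (H.integrable_sample_variance i w)

theorem memLp_batchGrad (H : Assumptions p D ℓ L ρ σ σt α) (n : ℕ) (i : I) (w : Param d) :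
    MemLp (fun S : Fin n → Θ => batchGrad ℓ i w S) 2 (Measure.pi fun _ => D i) :=
  memLp_sampleMean (H.memLp_sampleGrad i w) n

theorem integral_batchGrad (H : Assumptions p D ℓ L ρ σ σt α) {n : ℕ} (hn : 0 < n) (i : I)
    (w : Param d) :
    ∫ S : Fin n → Θ, batchGrad ℓ i w S ∂(Measure.pi fun _ => D i) = ∇ (taskLoss D ℓ i) w := by
  rw [← H.unbiased]
  exact integral_sampleMean ((H.memLp_sampleGrad i w).integrable one_le_two) hn

theorem batch_variance_le (H : Assumptions p D ℓ L ρ σ σt α) {n : ℕ} (hn : 0 < n) (i : I)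
    (w : Param d) :
    ∫ S : Fin n → Θ, ‖batchGrad ℓ i w S - ∇ (taskLoss D ℓ i) w‖ ^ 2 ∂(Measure.pi fun _ => D i)
      ≤ σt ^ 2 / n := by
  have h1 := integral_norm_sampleMean_sub_sq_le (H.memLp_sampleGrad i w) hn
    (∇ (taskLoss D ℓ i) w)
  rw [H.unbiased] at h1
  exact h1.trans (div_le_div_of_nonneg_right (H.sample_variance_le i w) (Nat.cast_nonneg n))

theorem integral_norm_batchGrad_sub_le (H : Assumptions p D ℓ L ρ σ σt α) {n : ℕ} (hn : 0 < n)
    (i : I) (w : Param d) :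
    ∫ S : Fin n → Θ, ‖batchGrad ℓ i w S - ∇ (taskLoss D ℓ i) w‖ ∂(Measure.pi fun _ => D i)
      ≤ σt / √n := by
  refine integral_norm_sub_le_sqrt (H.memLp_batchGrad n i w) _ ?_
    (div_nonneg H.sigmat_nonneg (Real.sqrt_nonneg _))
  rw [div_pow, Real.sq_sqrt (Nat.cast_nonneg n)]
  exact H.batch_variance_le hn i w

theorem integral_norm_batchGrad_sub_sq_le (H : Assumptions p D ℓ L ρ σ σt α) {n : ℕ} (hn : 0 < n)
    (i : I) (w c : Param d) :
    ∫ S : Fin n → Θ, ‖batchGrad ℓ i w S - c‖ ^ 2 ∂(Measure.pi fun _ => D i)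
      ≤ σt ^ 2 / n + ‖∇ (taskLoss D ℓ i) w - c‖ ^ 2 := by
  rw [integral_norm_sub_sq_eq (H.memLp_batchGrad n i w) c, H.integral_batchGrad hn]
  linarith [H.batch_variance_le hn i w]

end Assumptions

/-! ### Second moment and bias of the update gradient for a fixed task. -/

/-- The law of the two batches of an `UpdateDraw` with task `i`. -/
abbrev batchLaw {I Θ : Type*} [MeasurableSpace Θ] (D : I → Measure Θ) (Din Do : ℕ) (i : I) :
    Measure ((Fin Din → Θ) × (Fin Do → Θ)) :=
  (Measure.pi fun _ : Fin Din => D i).prod (Measure.pi fun _ : Fin Do => D i)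

/-- The stochastic gradient contributed by one task draw of the meta update. -/
def updateGrad {d : ℕ} {I Θ : Type*} (ℓ : I → Param d → Θ → ℝ) (α : ℝ) {Din Do : ℕ} (w : Param d)
    (s : UpdateDraw I Θ Din Do) : Param d :=
  batchGrad ℓ s.1 (w - α • batchGrad ℓ s.1 w s.2.1) s.2.2

namespace Assumptions

variable {d : ℕ} {I Θ : Type*} [MeasurableSpace I] [Countable I] [DiscreteMeasurableSpace I]
  [MeasurableSpace Θ] {p : Measure I} [IsProbabilityMeasure p] {D : I → Measure Θ}
  [∀ i, IsProbabilityMeasure (D i)]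
  {ℓ : I → Param d → Θ → ℝ} {L ρ σ σt α : ℝ}

theorem measurable_updateGrad (H : Assumptions p D ℓ L ρ σ σt α) {X : Type*} [MeasurableSpace X]
    {Din Do : ℕ} {w : X → Param d} {s : X → UpdateDraw I Θ Din Do} (hw : Measurable w)
    (hs : Measurable s) : Measurable fun x => updateGrad ℓ α (w x) (s x) := by
  have h1 : Measurable fun x => (s x).1 := measurable_fst.comp hs
  have h2 : Measurable fun x => (s x).2.1 := (measurable_fst.comp measurable_snd).comp hs
  have h3 : Measurable fun x => (s x).2.2 := (measurable_snd.comp measurable_snd).comp hs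
  exact H.measurable_batchGrad h1 (hw.sub ((H.measurable_batchGrad h1 hw h2).const_smul α)) h3

section Fixed

variable {Din Do : ℕ}

theorem norm_gradient_sub_sq_le (H : Assumptions p D ℓ L ρ σ σt α) (i : I) (w v c : Param d) :
    ‖∇ (taskLoss D ℓ i) (w - α • v) - c‖ ^ 2
      ≤ 3 * ((α * L) ^ 2 * ‖v - ∇ (taskLoss D ℓ i) w‖ ^ 2
        + (α * L) ^ 2 * ‖∇ (taskLoss D ℓ i) w‖ ^ 2 + ‖∇ (taskLoss D ℓ i) w - c‖ ^ 2) := by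
  set g := ∇ (taskLoss D ℓ i) w
  have h1 := H.smooth i (w - α • v) w
  rw [sub_sub_cancel_left, norm_neg, norm_smul, Real.norm_of_nonneg H.alpha_nonneg] at h1
  have h2 := norm_le_norm_sub_add v g
  have hq : 0 ≤ α * L := mul_nonneg H.alpha_nonneg H.L_pos.le
  have h3 := norm_sub_le_norm_sub_add_norm_sub (∇ (taskLoss D ℓ i) (w - α • v)) g c
  have h4 : ‖∇ (taskLoss D ℓ i) (w - α • v) - c‖
      ≤ (α * L) * ‖v - g‖ + (α * L) * ‖g‖ + ‖g - c‖ := by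
    have := mul_le_mul_of_nonneg_left h2 hq
    linarith
  refine (pow_le_pow_left₀ (norm_nonneg _) h4 2).trans ?_
  nlinarith [sq_nonneg ((α * L) * ‖v - g‖ - (α * L) * ‖g‖), sq_nonneg ((α * L) * ‖g‖ - ‖g - c‖),
    sq_nonneg ((α * L) * ‖v - g‖ - ‖g - c‖)]

/-- Given the inner batch, the outer batch contributes its variance plus a squared distance from its
mean `∇f_i(w - αv)` to `c`; `norm_gradient_sub_sq_le` controls that distance and is averaged over
the inner batch. -/
theorem integral_norm_updateGrad_sub_sq (H : Assumptions p D ℓ L ρ σ σt α) (hin : 0 < Din)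
    (ho : 0 < Do) (i : I) (w c : Param d) :
    Integrable (fun s : (Fin Din → Θ) × (Fin Do → Θ) => ‖updateGrad ℓ α w (i, s) - c‖ ^ 2)
      (batchLaw D Din Do i) ∧
    ∫ s, ‖updateGrad ℓ α w (i, s) - c‖ ^ 2 ∂(batchLaw D Din Do i)
      ≤ σt ^ 2 / Do + 3 * ((α * L) ^ 2 * (σt ^ 2 / Din)
        + (α * L) ^ 2 * ‖∇ (taskLoss D ℓ i) w‖ ^ 2 + ‖∇ (taskLoss D ℓ i) w - c‖ ^ 2) := by
  set g := ∇ (taskLoss D ℓ i) w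
  set h : (Fin Din → Θ) → ℝ := fun a => σt ^ 2 / Do + 3 * ((α * L) ^ 2 * ‖batchGrad ℓ i w a - g‖ ^ 2
    + (α * L) ^ 2 * ‖g‖ ^ 2 + ‖g - c‖ ^ 2) with hdef
  have hv : Integrable (fun a : Fin Din → Θ => ‖batchGrad ℓ i w a - g‖ ^ 2)
      (Measure.pi fun _ => D i) := MemLp.integrable_norm_sub_sq (H.memLp_batchGrad Din i w) g
  have h1 : Integrable (fun a : Fin Din → Θ => (α * L) ^ 2 * ‖batchGrad ℓ i w a - g‖ ^ 2
      + (α * L) ^ 2 * ‖g‖ ^ 2) (Measure.pi fun _ => D i) :=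
    (hv.const_mul _).add (integrable_const _)
  have h2 : Integrable (fun a : Fin Din → Θ => (α * L) ^ 2 * ‖batchGrad ℓ i w a - g‖ ^ 2
      + (α * L) ^ 2 * ‖g‖ ^ 2 + ‖g - c‖ ^ 2) (Measure.pi fun _ => D i) :=
    h1.add (integrable_const _)
  have hh : Integrable h (Measure.pi fun _ => D i) := (integrable_const _).add (h2.const_mul 3)
  have hle : ∀ a, ∫ b : Fin Do → Θ, ‖updateGrad ℓ α w (i, (a, b)) - c‖ ^ 2
      ∂(Measure.pi fun _ => D i) ≤ h a := fun a => by
    refine (H.integral_norm_batchGrad_sub_sq_le ho i (w - α • batchGrad ℓ i w a) c).trans ?_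
    have := H.norm_gradient_sub_sq_le i w (batchGrad ℓ i w a) c
    simp only [hdef]
    linarith
  have hm : Measurable fun s : (Fin Din → Θ) × (Fin Do → Θ) =>
      ‖updateGrad ℓ α w (i, s) - c‖ ^ 2 :=
    (((H.measurable_updateGrad measurable_const
      (measurable_const.prodMk measurable_id)).sub_const c).norm).pow_const 2
  have hint : Integrable (fun s : (Fin Din → Θ) × (Fin Do → Θ) =>
      ‖updateGrad ℓ α w (i, s) - c‖ ^ 2) (batchLaw D Din Do i) := by
    refine integrable_prod_of_integral_norm_le hm.aestronglyMeasurable (fun a => ?_)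
      (fun a => ?_) hh
    · exact MemLp.integrable_norm_sub_sq
        (H.memLp_batchGrad Do i (w - α • batchGrad ℓ i w a)) c
    · simpa using hle a
  refine ⟨hint, (integral_prod_le hint hle hh).trans ?_⟩
  simp only [hdef]
  rw [integral_add (integrable_const _) (h2.const_mul 3), integral_const_mul,
    integral_add h1 (integrable_const _), integral_add (hv.const_mul _) (integrable_const _),
    integral_const_mul]
  simp only [integral_const, probReal_univ, smul_eq_mul, one_mul]
  have := mul_le_mul_of_nonneg_left (H.batch_variance_le hin i w) (sq_nonneg (α * L))
  linarith

theorem memLp_updateGrad_task (H : Assumptions p D ℓ L ρ σ σt α) (hin : 0 < Din)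
    (ho : 0 < Do) (i : I) (w : Param d) :
    MemLp (fun s : (Fin Din → Θ) × (Fin Do → Θ) => updateGrad ℓ α w (i, s)) 2 (batchLaw D Din Do i) :=
  memLp_two_of_integrable_norm_sub_sq (c := 0)
    (H.measurable_updateGrad measurable_const
      (measurable_const.prodMk measurable_id)).aestronglyMeasurable
    (H.integral_norm_updateGrad_sub_sq hin ho i w 0).1

/-- The outer batch is unbiased at the randomly adapted point. Two errors remain: the omitted
Hessian factor, and the inner noise, which moves the adapted point by `α‖v - ∇f_i(w)‖` and enters
through the Lipschitz constant `L`. -/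
theorem norm_integral_updateGrad_sub_task_le (H : Assumptions p D ℓ L ρ σ σt α) (hin : 0 < Din)
    (ho : 0 < Do) (i : I) (w : Param d) :
    ‖∫ s, updateGrad ℓ α w (i, s) ∂(batchLaw D Din Do i) - adaptedGrad (taskLoss D ℓ i) α w‖
      ≤ 11 / 10 * (α * L) * ‖∇ (taskLoss D ℓ i) w‖ + α * L * (σt / √Din) := by
  set g := ∇ (taskLoss D ℓ i) w
  have hi := (H.memLp_updateGrad_task hin ho i w).integrable one_le_two
  have h1 : ∫ s, updateGrad ℓ α w (i, s) ∂(batchLaw D Din Do i)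
      = ∫ a : Fin Din → Θ, ∇ (taskLoss D ℓ i) (w - α • batchGrad ℓ i w a)
        ∂(Measure.pi fun _ => D i) := by
    rw [integral_prod _ hi]
    exact integral_congr_ae (Filter.Eventually.of_forall fun a =>
      H.integral_batchGrad ho i (w - α • batchGrad ℓ i w a))
  have h2 : Integrable (fun a : Fin Din → Θ => ∇ (taskLoss D ℓ i) (w - α • batchGrad ℓ i w a))
      (Measure.pi fun _ => D i) :=
    hi.integral_prod_left.congr (Filter.Eventually.of_forall fun a =>
      H.integral_batchGrad ho i (w - α • batchGrad ℓ i w a))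
  have h3 : adaptedGrad (taskLoss D ℓ i) α w
      = ∫ _ : Fin Din → Θ, adaptedGrad (taskLoss D ℓ i) α w ∂(Measure.pi fun _ => D i) := by simp
  have hb : Integrable (fun a : Fin Din → Θ => ‖batchGrad ℓ i w a - g‖)
      (Measure.pi fun _ => D i) :=
    (((H.memLp_batchGrad Din i w).integrable one_le_two).sub (integrable_const g)).norm
  rw [h1, h3, ← integral_sub h2 (integrable_const _)]
  refine (norm_integral_le_of_norm_le
    (g := fun a => 11 / 10 * (α * L) * ‖g‖ + α * L * ‖batchGrad ℓ i w a - g‖)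
    ((integrable_const _).add (hb.const_mul _)) (Filter.Eventually.of_forall fun a => ?_)).trans ?_
  · have h4 := norm_adaptedGrad_sub_gradient_adapted_le H.L_pos.le (H.smooth i) H.alpha_nonneg
      H.alpha_mul_le w
    have h5 := H.smooth i (w - α • batchGrad ℓ i w a) (w - α • g)
    rw [sub_sub_sub_cancel_left, ← smul_sub, norm_smul, Real.norm_of_nonneg H.alpha_nonneg,
      norm_sub_rev g] at h5
    have h6 := norm_sub_le_norm_sub_add_norm_sub
      (∇ (taskLoss D ℓ i) (w - α • batchGrad ℓ i w a)) (∇ (taskLoss D ℓ i) (w - α • g))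
      (adaptedGrad (taskLoss D ℓ i) α w)
    rw [norm_sub_rev (∇ (taskLoss D ℓ i) (w - α • g)) (adaptedGrad (taskLoss D ℓ i) α w)] at h6
    change ‖adaptedGrad (taskLoss D ℓ i) α w - ∇ (taskLoss D ℓ i) (w - α • g)‖
      ≤ 11 / 10 * (α * L) * ‖g‖ at h4
    linarith
  · rw [integral_add (integrable_const _) (hb.const_mul _), integral_const_mul (α * L)]
    simp only [integral_const, probReal_univ, smul_eq_mul, one_mul]
    have := mul_le_mul_of_nonneg_left (H.integral_norm_batchGrad_sub_le hin i w)
      (mul_nonneg H.alpha_nonneg H.L_pos.le)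
    linarith

end Fixed

end Assumptions

end FOMAML

/-! ### Bias and second moment of the averaged update direction. -/

namespace FOMAML

/-- The squared noise level of one FO-MAML update. -/
def noiseSq (L σ σt α : ℝ) (B Din Do : ℕ) : ℝ :=
  σ ^ 2 * (α ^ 2 * L ^ 2 + 1 / B) + σt ^ 2 / (B * Do) + σt ^ 2 / Din

theorem noiseSq_nonneg (L σ σt α : ℝ) (B Din Do : ℕ) : 0 ≤ noiseSq L σ σt α B Din Do := by
  rw [noiseSq]; positivity

/-- The averaged update direction of one FO-MAML iteration. -/
def meanUpdate {d : ℕ} {I Θ : Type*} (ℓ : I → Param d → Θ → ℝ) (α : ℝ) {B Din Do : ℕ}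
    (w : Param d) (s : Fin B → UpdateDraw I Θ Din Do) : Param d :=
  (B : ℝ)⁻¹ • ∑ b, updateGrad ℓ α w (s b)

/-- The step is a scalar depending on the second component of the draw times a vector depending on
the first; these components are independent. -/
theorem foStep_eq {d : ℕ} {I Θ : Type*} (ℓ : I → Param d → Θ → ℝ) (L ρ α : ℝ)
    {B Din Do B' Dβ : ℕ} (w : Param d) (s : Draw I Θ B Din Do B' Dβ) :
    foStep ℓ L ρ α w s = w - (betaTilde ℓ L ρ α w s.2 / 18) • meanUpdate ℓ α w s.1 := by
  rw [foStep, meanUpdate, smul_smul, div_eq_mul_inv _ (B : ℝ)]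
  rfl

section Kernels

variable {I Y Θ : Type*} [MeasurableSpace I] [Countable I] [DiscreteMeasurableSpace I]
  [MeasurableSpace Y] [MeasurableSpace Θ]

instance isMarkovKernel_ofFunOfCountable (f : I → Measure Y) [∀ i, IsProbabilityMeasure (f i)] :
    IsMarkovKernel (Kernel.ofFunOfCountable f) :=
  ⟨fun i => inferInstanceAs (IsProbabilityMeasure (f i))⟩

variable (p : Measure I) [IsProbabilityMeasure p] (D : I → Measure Θ)
  [∀ i, IsProbabilityMeasure (D i)]

instance isProbabilityMeasure_updateLaw (Din Do : ℕ) :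
    IsProbabilityMeasure (updateLaw p D Din Do) := by
  unfold updateLaw; infer_instance

instance isProbabilityMeasure_stepLaw (Dβ : ℕ) : IsProbabilityMeasure (stepLaw p D Dβ) := by
  unfold stepLaw; infer_instance

instance isProbabilityMeasure_drawLaw (B Din Do B' Dβ : ℕ) :
    IsProbabilityMeasure (drawLaw p D B Din Do B' Dβ) := by
  unfold drawLaw; infer_instance

end Kernels

namespace Assumptions

variable {d : ℕ} {I Θ : Type*} [MeasurableSpace I] [Countable I] [DiscreteMeasurableSpace I]
  [MeasurableSpace Θ] {p : Measure I} [IsProbabilityMeasure p] {D : I → Measure Θ}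
  [∀ i, IsProbabilityMeasure (D i)]
  {ℓ : I → Param d → Θ → ℝ} {L ρ σ σt α : ℝ}

section Update

variable {B Din Do : ℕ}

theorem integral_norm_updateGrad_sub_meanLoss_sq (H : Assumptions p D ℓ L ρ σ σt α)
    (hin : 0 < Din) (ho : 0 < Do) (w : Param d) :
    Integrable (fun s => ‖updateGrad ℓ α w s - ∇ (meanLoss p D ℓ) w‖ ^ 2) (updateLaw p D Din Do) ∧
    ∫ s, ‖updateGrad ℓ α w s - ∇ (meanLoss p D ℓ) w‖ ^ 2 ∂(updateLaw p D Din Do)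
      ≤ σt ^ 2 / Do + 3 * ((α * L) ^ 2 * (σt ^ 2 / Din)
        + (α * L) ^ 2 * (‖∇ (meanLoss p D ℓ) w‖ ^ 2 + σ ^ 2) + σ ^ 2) := by
  set c := ∇ (meanLoss p D ℓ) w
  have hi1 : Integrable (fun i => ‖∇ (taskLoss D ℓ i) w‖ ^ 2) p :=
    (H.memLp_taskGrad w).integrable_norm_pow two_ne_zero
  have hi2 : Integrable (fun i => ‖∇ (taskLoss D ℓ i) w - c‖ ^ 2) p :=
    MemLp.integrable_norm_sub_sq (H.memLp_taskGrad w) c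
  set h : I → ℝ := fun i => σt ^ 2 / Do + 3 * ((α * L) ^ 2 * (σt ^ 2 / Din)
        + (α * L) ^ 2 * ‖∇ (taskLoss D ℓ i) w‖ ^ 2 + ‖∇ (taskLoss D ℓ i) w - c‖ ^ 2) with hdef
  have h1 : Integrable (fun i => (α * L) ^ 2 * (σt ^ 2 / Din)
        + (α * L) ^ 2 * ‖∇ (taskLoss D ℓ i) w‖ ^ 2) p :=
    (integrable_const _).add (hi1.const_mul _)
  have h2 : Integrable (fun i => (α * L) ^ 2 * (σt ^ 2 / Din)
        + (α * L) ^ 2 * ‖∇ (taskLoss D ℓ i) w‖ ^ 2 + ‖∇ (taskLoss D ℓ i) w - c‖ ^ 2) p :=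
    h1.add hi2
  have hh : Integrable h p := (integrable_const _).add (h2.const_mul 3)
  have hle := fun i => H.integral_norm_updateGrad_sub_sq hin ho i w c
  have hm : Measurable fun s : UpdateDraw I Θ Din Do => ‖updateGrad ℓ α w s - c‖ ^ 2 :=
    (((H.measurable_updateGrad measurable_const measurable_id).sub_const c).norm).pow_const 2
  have hint : Integrable (fun s => ‖updateGrad ℓ α w s - c‖ ^ 2) (updateLaw p D Din Do) :=
    integrable_compProd_of_integral_norm_le hm.aestronglyMeasurable (fun i => (hle i).1)
      (fun i => by
        simp only [norm_pow, norm_norm]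
        exact (hle i).2) hh
  refine ⟨hint, (integral_compProd_le hint (fun i => (hle i).2) hh).trans ?_⟩
  rw [integral_add (integrable_const _) (h2.const_mul 3), integral_const_mul,
    integral_add h1 hi2, integral_add (integrable_const _) (hi1.const_mul _),
    integral_const_mul ((α * L) ^ 2) (fun i => ‖∇ (taskLoss D ℓ i) w‖ ^ 2)]
  simp only [integral_const, probReal_univ, smul_eq_mul, one_mul]
  have h3 := mul_le_mul_of_nonneg_left (H.integral_norm_taskGrad_sq_le w) (sq_nonneg (α * L))
  have h4 := H.integral_norm_gradient_sub_le w
  rw [show ∇ (meanLoss p D ℓ) w = c from rfl] at h3 h4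
  linarith

theorem memLp_updateGrad (H : Assumptions p D ℓ L ρ σ σt α) (hin : 0 < Din) (ho : 0 < Do)
    (w : Param d) : MemLp (updateGrad ℓ α w) 2 (updateLaw p D Din Do) :=
  memLp_two_of_integrable_norm_sub_sq
    (H.measurable_updateGrad measurable_const measurable_id).aestronglyMeasurable
    (H.integral_norm_updateGrad_sub_meanLoss_sq hin ho w).1

theorem norm_integral_updateGrad_sub_le (H : Assumptions p D ℓ L ρ σ σt α) (hin : 0 < Din)
    (ho : 0 < Do) (w : Param d) :
    ‖∫ s, updateGrad ℓ α w s ∂(updateLaw p D Din Do) - ∇ (metaLoss p D ℓ α) w‖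
      ≤ 11 / 10 * (α * L) * meanGradNorm p D ℓ w + α * L * (σt / √Din) := by
  have hi := (H.memLp_updateGrad hin ho w).integrable one_le_two
  have hi' : Integrable (fun i => ∫ s, updateGrad ℓ α w (i, s) ∂(batchLaw D Din Do i)) p := by
    have : Integrable (updateGrad ℓ α w) ((Kernel.const Unit p ⊗ₖ Kernel.prodMkLeft Unit
      (Kernel.ofFunOfCountable (batchLaw D Din Do))) ()) := hi
    exact this.integral_compProd
  have h1 : ∫ s, updateGrad ℓ α w s ∂(updateLaw p D Din Do)
      = ∫ i, ∫ s, updateGrad ℓ α w (i, s) ∂(batchLaw D Din Do i) ∂p :=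
    Measure.integral_compProd hi
  have hN := (H.integrable_taskGrad w).norm.const_mul (11 / 10 * (α * L))
  rw [h1, H.gradient_metaLoss, ← integral_sub hi' (H.integrable_adaptedGrad w)]
  refine (norm_integral_le_of_norm_le (hN.add (integrable_const (α * L * (σt / √Din))))
    (Filter.Eventually.of_forall fun i =>
      H.norm_integral_updateGrad_sub_task_le hin ho i w)).trans ?_
  simp only [Pi.add_apply]
  rw [integral_add hN (integrable_const _), integral_const_mul]
  simp [meanGradNorm]

/-- Here `1.1 · 1.27 ≤ 1.4`. The bound `αL ≤ 1/10` is spent on the gradient and `σt` terms only: the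
`σ` term keeps its factor `αL`, because the noise level contains `σ²` only with weight `α²L² + 1/B`.
-/
theorem norm_integral_updateGrad_sub_le_add (H : Assumptions p D ℓ L ρ σ σt α) (hin : 0 < Din)
    (ho : 0 < Do) (w : Param d) :
    ‖∫ s, updateGrad ℓ α w s ∂(updateLaw p D Din Do) - ∇ (metaLoss p D ℓ α) w‖
      ≤ 14 / 100 * ‖∇ (metaLoss p D ℓ α) w‖ + (14 / 10 * (α * L * σ) + 1 / 10 * (σt / √Din)) := by
  have h1 := H.norm_integral_updateGrad_sub_le hin ho w
  have h2 := H.meanGradNorm_le w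
  have hq : 0 ≤ α * L := mul_nonneg H.alpha_nonneg H.L_pos.le
  have h3 := mul_le_mul_of_nonneg_left h2 hq
  have h4 : 0 ≤ σt / √Din := div_nonneg H.sigmat_nonneg (Real.sqrt_nonneg _)
  have h5 := mul_le_mul_of_nonneg_right H.alpha_mul_le h4
  have h6 := mul_le_mul_of_nonneg_right H.alpha_mul_le (norm_nonneg (∇ (metaLoss p D ℓ α) w))
  have h7 := mul_nonneg hq H.sigma_nonneg
  linarith [norm_nonneg (∇ (metaLoss p D ℓ α) w)]

theorem bias_sq_le :
    (14 / 10 * (α * L * σ) + 1 / 10 * (σt / √Din)) ^ 2 ≤ 4 * noiseSq L σ σt α B Din Do := by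
  have h1 : (σt / √Din) ^ 2 = σt ^ 2 / Din := by rw [div_pow, Real.sq_sqrt (Nat.cast_nonneg _)]
  have h2 : 0 ≤ σ ^ 2 * (1 / B) + σt ^ 2 / (B * Do) := by positivity
  have h3 : 0 ≤ σt ^ 2 / Din := by positivity
  rw [noiseSq]
  nlinarith [sq_nonneg (14 / 10 * (α * L * σ) - 1 / 10 * (σt / √Din)), sq_nonneg (α * L * σ)]

theorem memLp_meanUpdate (H : Assumptions p D ℓ L ρ σ σt α) (hin : 0 < Din)
    (ho : 0 < Do) (w : Param d) :
    MemLp (meanUpdate (B := B) (Din := Din) (Do := Do) ℓ α w) 2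
      (Measure.pi fun _ => updateLaw p D Din Do) :=
  memLp_sampleMean (H.memLp_updateGrad hin ho w) B

theorem integral_meanUpdate (H : Assumptions p D ℓ L ρ σ σt α) (hB : 0 < B) (hin : 0 < Din)
    (ho : 0 < Do) (w : Param d) :
    ∫ s, meanUpdate (B := B) ℓ α w s ∂(Measure.pi fun _ => updateLaw p D Din Do)
      = ∫ s, updateGrad ℓ α w s ∂(updateLaw p D Din Do) :=
  integral_sampleMean ((H.memLp_updateGrad hin ho w).integrable one_le_two) hB

theorem le_inner_integral_meanUpdate (H : Assumptions p D ℓ L ρ σ σt α) (hB : 0 < B)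
    (hin : 0 < Din) (ho : 0 < Do) (w : Param d) :
    61 / 100 * ‖∇ (metaLoss p D ℓ α) w‖ ^ 2 - 4 * noiseSq L σ σt α B Din Do
      ≤ ∫ s, inner ℝ (∇ (metaLoss p D ℓ α) w) (meanUpdate (B := B) ℓ α w s)
        ∂(Measure.pi fun _ => updateLaw p D Din Do) := by
  rw [integral_inner ((H.memLp_meanUpdate hin ho w).integrable one_le_two),
    H.integral_meanUpdate hB hin ho]
  have h1 := H.norm_integral_updateGrad_sub_le_add hin ho w
  have h2 := bias_sq_le (L := L) (σ := σ) (σt := σt) (α := α) (B := B) (Din := Din) (Do := Do)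
  set m := ∫ s, updateGrad ℓ α w s ∂(updateLaw p D Din Do)
  set g := ∇ (metaLoss p D ℓ α) w
  set δ := 14 / 10 * (α * L * σ) + 1 / 10 * (σt / √Din)
  have h3 : inner ℝ g m = ‖g‖ ^ 2 + inner ℝ g (m - g) := by
    rw [inner_sub_right, real_inner_self_eq_norm_sq]; ring
  have h4 := neg_le_of_abs_le (abs_real_inner_le_norm g (m - g))
  have h5 := mul_le_mul_of_nonneg_left h1 (norm_nonneg g)
  -- `‖g‖δ ≤ ‖g‖²/4 + δ²`, and `1 - 0.14 - 0.25 = 0.61`.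
  nlinarith [sq_nonneg (‖g‖ / 2 - δ)]

theorem integral_norm_meanUpdate_sq_le (H : Assumptions p D ℓ L ρ σ σt α) (hB : 20 ≤ B)
    (hin : 0 < Din) (ho : 0 < Do) (w : Param d) :
    ∫ s, ‖meanUpdate (B := B) ℓ α w s‖ ^ 2 ∂(Measure.pi fun _ => updateLaw p D Din Do)
      ≤ 27 / 10 * ‖∇ (metaLoss p D ℓ α) w‖ ^ 2 + 14 * noiseSq L σ σt α B Din Do := by
  have hB0 : 0 < B := by omega
  have h0 := integral_norm_sub_sq_eq
    (H.memLp_meanUpdate (B := B) (Din := Din) (Do := Do) hin ho w) 0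
  simp only [sub_zero] at h0
  rw [H.integral_meanUpdate hB0 hin ho] at h0
  have h1 := H.norm_integral_updateGrad_sub_le_add hin ho w
  have h2 := bias_sq_le (L := L) (σ := σ) (σt := σt) (α := α) (B := B) (Din := Din) (Do := Do)
  have h3 := integral_norm_sampleMean_sub_sq_le (H.memLp_updateGrad hin ho w) hB0
    (∇ (meanLoss p D ℓ) w)
  have h4 := (H.integral_norm_updateGrad_sub_meanLoss_sq hin ho w).2
  set m := ∫ s, updateGrad ℓ α w s ∂(updateLaw p D Din Do)
  set g := ∇ (metaLoss p D ℓ α) w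
  set c := ∇ (meanLoss p D ℓ) w
  set δ := 14 / 10 * (α * L * σ) + 1 / 10 * (σt / √Din)
  have h5 := norm_le_norm_sub_add m g
  have h6 : ‖m‖ ^ 2 ≤ 26 / 10 * ‖g‖ ^ 2 + 2 * δ ^ 2 := by
    have : ‖m‖ ≤ 114 / 100 * ‖g‖ + δ := by linarith
    have := pow_le_pow_left₀ (norm_nonneg m) this 2
    nlinarith [sq_nonneg (114 / 100 * ‖g‖ - δ), sq_nonneg ‖g‖]
  have h7 : ‖c‖ ^ 2 ≤ 33 / 10 * ‖g‖ ^ 2 + 2 / 10 * σ ^ 2 := by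
    have := pow_le_pow_left₀ (norm_nonneg c) (H.norm_gradient_meanLoss_le w) 2
    nlinarith [sq_nonneg (127 / 100 * ‖g‖ - 27 / 100 * σ), sq_nonneg ‖g‖, sq_nonneg σ]
  have hq : (α * L) ^ 2 ≤ 1 / 100 := by
    have := pow_le_pow_left₀ (mul_nonneg H.alpha_nonneg H.L_pos.le) H.alpha_mul_le 2
    linarith
  have h8 : ∫ s, ‖updateGrad ℓ α w s - c‖ ^ 2 ∂(updateLaw p D Din Do)
      ≤ σt ^ 2 / Do + σt ^ 2 / Din + 4 * σ ^ 2 + ‖g‖ ^ 2 := by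
    have a1 := mul_le_mul_of_nonneg_right hq (show 0 ≤ σt ^ 2 / Din by positivity)
    have a2 := mul_le_mul_of_nonneg_right hq (show 0 ≤ ‖c‖ ^ 2 + σ ^ 2 by positivity)
    have a3 : 0 ≤ σt ^ 2 / Din := by positivity
    nlinarith [sq_nonneg ‖g‖, sq_nonneg σ]
  have hBr : (20 : ℝ) ≤ B := by exact_mod_cast hB
  -- Here `B ≥ 20` turns the gradient part of the per-task variance into `‖g‖²/20`, small enough for
  -- the final `2.7 ≥ 2.6 + 0.05`.
  have h9 : (∫ s, ‖updateGrad ℓ α w s - c‖ ^ 2 ∂(updateLaw p D Din Do)) / B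
      ≤ 4 * noiseSq L σ σt α B Din Do + 1 / 20 * ‖g‖ ^ 2 := by
    refine (div_le_div_of_nonneg_right h8 (Nat.cast_nonneg B)).trans ?_
    have b1 : (1 : ℝ) / B ≤ 1 / 20 := one_div_le_one_div_of_le (by norm_num) hBr
    have b2 : (σt ^ 2 / Do + σt ^ 2 / Din + 4 * σ ^ 2 + ‖g‖ ^ 2) / (B : ℝ)
        = σt ^ 2 / (B * Do) + (σt ^ 2 / Din) * (1 / B) + 4 * (σ ^ 2 * (1 / B))
          + ‖g‖ ^ 2 * (1 / B) := by
      field_simp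
    have b3 := mul_le_mul_of_nonneg_left b1 (show 0 ≤ σt ^ 2 / Din by positivity)
    have b4 := mul_le_mul_of_nonneg_left b1 (sq_nonneg ‖g‖)
    have b5 : 0 ≤ σt ^ 2 / (B * Do) := by positivity
    have b6 : 0 ≤ σt ^ 2 / Din := by positivity
    have b7 : 0 ≤ σ ^ 2 * (α ^ 2 * L ^ 2) := by positivity
    rw [b2, noiseSq]
    linarith
  have h10 : ∫ s, ‖meanUpdate (B := B) ℓ α w s - m‖ ^ 2
      ∂(Measure.pi fun _ => updateLaw p D Din Do)
      ≤ 4 * noiseSq L σ σt α B Din Do + 1 / 20 * ‖g‖ ^ 2 := h3.trans h9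
  have h11 := noiseSq_nonneg L σ σt α B Din Do
  nlinarith [sq_nonneg ‖g‖]

end Update

/-! ### Moments of the gradient norms entering the step size. -/

section StepSize

variable {B' Dβ : ℕ}

theorem memLp_batchGrad_stepLaw (H : Assumptions p D ℓ L ρ σ σt α) (hβ : 0 < Dβ) (w : Param d) :
    MemLp (fun T : StepDraw I Θ Dβ => batchGrad ℓ T.1 w T.2) 2 (stepLaw p D Dβ) ∧
    ∫ T, ‖batchGrad ℓ T.1 w T.2 - ∇ (meanLoss p D ℓ) w‖ ^ 2 ∂(stepLaw p D Dβ)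
      ≤ σt ^ 2 / Dβ + σ ^ 2 := by
  set c := ∇ (meanLoss p D ℓ) w
  have hi2 : Integrable (fun i => ‖∇ (taskLoss D ℓ i) w - c‖ ^ 2) p :=
    MemLp.integrable_norm_sub_sq (H.memLp_taskGrad w) c
  have hh : Integrable (fun i => σt ^ 2 / Dβ + ‖∇ (taskLoss D ℓ i) w - c‖ ^ 2) p :=
    (integrable_const _).add hi2
  have hm : Measurable fun T : StepDraw I Θ Dβ => batchGrad ℓ T.1 w T.2 :=
    H.measurable_batchGrad measurable_fst measurable_const measurable_snd
  have hle := fun i => H.integral_norm_batchGrad_sub_sq_le hβ i w c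
  have hint : Integrable (fun T : StepDraw I Θ Dβ => ‖batchGrad ℓ T.1 w T.2 - c‖ ^ 2)
      (stepLaw p D Dβ) :=
    integrable_compProd_of_integral_norm_le
      (((hm.sub_const c).norm).pow_const 2).aestronglyMeasurable
      (fun i => MemLp.integrable_norm_sub_sq (H.memLp_batchGrad Dβ i w) c)
      (fun i => by
        simp only [norm_pow, norm_norm]
        exact hle i) hh
  refine ⟨memLp_two_of_integrable_norm_sub_sq hm.aestronglyMeasurable hint,
    (integral_compProd_le hint hle hh).trans ?_⟩
  rw [integral_add (integrable_const _) hi2]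
  simp only [integral_const, probReal_univ, smul_eq_mul, one_mul]
  linarith [H.integral_norm_gradient_sub_le w]

/-- Task by task, the lower bound is Jensen's inequality for an unbiased estimator and the upper
bound is the triangle inequality with the batch standard deviation. -/
theorem integral_norm_batchGrad_stepLaw (H : Assumptions p D ℓ L ρ σ σt α) (hβ : 0 < Dβ)
    (w : Param d) :
    meanGradNorm p D ℓ w ≤ ∫ T, ‖batchGrad ℓ T.1 w T.2‖ ∂(stepLaw p D Dβ) ∧
    ∫ T, ‖batchGrad ℓ T.1 w T.2‖ ∂(stepLaw p D Dβ) ≤ meanGradNorm p D ℓ w + σt / √Dβ := by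
  have hi : Integrable (fun T : StepDraw I Θ Dβ => ‖batchGrad ℓ T.1 w T.2‖) (stepLaw p D Dβ) :=
    ((H.memLp_batchGrad_stepLaw hβ w).1.integrable one_le_two).norm
  have hb : ∀ i, Integrable (fun S : Fin Dβ → Θ => batchGrad ℓ i w S)
      (Measure.pi fun _ => D i) := fun i => (H.memLp_batchGrad Dβ i w).integrable one_le_two
  have hN := (H.integrable_taskGrad w).norm
  constructor
  · have hi' : Integrable (fun i => ∫ S : Fin Dβ → Θ, ‖batchGrad ℓ i w S‖
        ∂(Measure.pi fun _ => D i)) p := by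
      have : Integrable (fun T : StepDraw I Θ Dβ => ‖batchGrad ℓ T.1 w T.2‖)
        ((Kernel.const Unit p ⊗ₖ Kernel.prodMkLeft Unit
          (Kernel.ofFunOfCountable fun i => Measure.pi fun _ : Fin Dβ => D i)) ()) := hi
      exact this.integral_compProd
    refine le_of_le_of_eq (integral_mono hN hi' fun i => ?_) (Measure.integral_compProd hi).symm
    simp only
    rw [← H.integral_batchGrad hβ]
    exact norm_integral_le_integral_norm _
  · refine (integral_compProd_le (h := fun i => ‖∇ (taskLoss D ℓ i) w‖ + σt / √Dβ) hi
      (fun i => ?_) (hN.add (integrable_const _))).trans ?_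
    · have h1 := ((hb i).sub (integrable_const (∇ (taskLoss D ℓ i) w))).norm
      refine (integral_mono (hb i).norm ((integrable_const ‖∇ (taskLoss D ℓ i) w‖).add h1)
        fun S => ?_).trans ?_
      · simp only [Pi.add_apply, Pi.sub_apply]
        rw [add_comm]
        exact norm_le_norm_sub_add _ _
      · simp only [Pi.add_apply, Pi.sub_apply] at h1 ⊢
        rw [integral_add (integrable_const _) h1]
        simp only [integral_const, probReal_univ, smul_eq_mul, one_mul]
        linarith [H.integral_norm_batchGrad_sub_le hβ i w]
    · rw [integral_add hN (integrable_const _)]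
      simp [meanGradNorm]

end StepSize

end Assumptions

end FOMAML

/-! ### Moments of the random step size. -/

namespace FOMAML

/-- Moments of `1 / X` for a random variable `X` bounded below by `c` with mean `μ`. -/
theorem integral_inv_bounds {X : Type*} [MeasurableSpace X] {P : Measure X}
    [IsProbabilityMeasure P] {f : X → ℝ} {c μ Λ : ℝ} (hf : MemLp f 2 P) (hc : 0 < c)
    (hcf : ∀ x, c ≤ f x) (hμ : ∫ x, f x ∂P = μ) (hΛ : 0 < Λ) (h1 : Λ ≤ μ) (h2 : μ ≤ 5 / 4 * Λ)
    (hvar : ∫ x, ‖f x - μ‖ ^ 2 ∂P ≤ 9 / 16 * c ^ 2) :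
    4 / 5 / Λ ≤ ∫ x, (1 / f x) ∂P ∧ ∫ x, (1 / f x) ∂P ≤ 207 / 100 / Λ ∧
      ∫ x, (1 / f x) ^ 2 ∂P ≤ 25 / 8 / Λ ^ 2 := by
  have hpos : ∀ x, 0 < f x := fun x => hc.trans_le (hcf x)
  have hm : AEStronglyMeasurable (fun x => 1 / f x) P := by
    have := hf.1.aemeasurable.const_div 1
    exact this.aestronglyMeasurable
  have hle : ∀ x, 1 / f x ≤ 1 / c := fun x => one_div_le_one_div_of_le hc (hcf x)
  have hb : MemLp (fun x => 1 / f x) 2 P :=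
    MemLp.of_bound hm (1 / c) (Filter.Eventually.of_forall fun x => by
      rw [Real.norm_of_nonneg (one_div_pos.2 (hpos x)).le]; exact hle x)
  have hi := hb.integrable one_le_two
  have hi2 : Integrable (fun x => (1 / f x) ^ 2) P := hb.integrable_sq
  have hfi := hf.integrable one_le_two
  have hv : Integrable (fun x => ‖f x - μ‖ ^ 2) P := MemLp.integrable_norm_sub_sq hf μ
  have hsq : ∫ x, (1 / f x) ^ 2 ∂P ≤ 25 / 8 / Λ ^ 2 := by
    have hμ0 : 0 < μ := hΛ.trans_le h1
    -- Divide `μ² ≤ 2f² + 2(f - μ)²` by `μ²f²` and use `f ≥ c` in the second term. The variance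
    -- bound then yields `2 + 9/8 = 25/8`.
    have hpt : ∀ x, (1 / f x) ^ 2 ≤ 2 / μ ^ 2 + 2 / (μ ^ 2 * c ^ 2) * ‖f x - μ‖ ^ 2 := fun x => by
      have h3 : 1 ≤ (f x / c) ^ 2 := one_le_pow₀ ((one_le_div hc).2 (hcf x))
      rw [Real.norm_eq_abs, sq_abs]
      have h4 : (1 / f x) ^ 2 = μ ^ 2 / (μ ^ 2 * f x ^ 2) := by
        have := (hpos x).ne'
        field_simp
      have h5 : 2 / μ ^ 2 + 2 / (μ ^ 2 * c ^ 2) * (f x - μ) ^ 2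
          = (2 * f x ^ 2 + 2 * (f x / c) ^ 2 * (f x - μ) ^ 2) / (μ ^ 2 * f x ^ 2) := by
        have := (hpos x).ne'
        field_simp
      rw [h4, h5]
      refine div_le_div_of_nonneg_right ?_ (by positivity)
      nlinarith [sq_nonneg (f x - μ - f x), mul_le_mul_of_nonneg_right h3 (sq_nonneg (f x - μ)),
        sq_nonneg (2 * f x - μ)]
    have h6 := integral_mono hi2 ((integrable_const _).add (hv.const_mul _)) hpt
    simp only [Pi.add_apply] at h6
    rw [integral_add (integrable_const _) (hv.const_mul _), integral_const_mul (2 / (μ ^ 2 * c ^ 2))]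
      at h6
    simp only [integral_const, probReal_univ, smul_eq_mul, one_mul] at h6
    have h7 := mul_le_mul_of_nonneg_left hvar (show 0 ≤ 2 / (μ ^ 2 * c ^ 2) by positivity)
    have h8 : 2 / (μ ^ 2 * c ^ 2) * (9 / 16 * c ^ 2) = 9 / 8 / μ ^ 2 := by field_simp; norm_num
    have h9 : 25 / 8 / μ ^ 2 ≤ 25 / 8 / Λ ^ 2 := by gcongr
    have h10 : (25 : ℝ) / 8 / μ ^ 2 = 2 / μ ^ 2 + 9 / 8 / μ ^ 2 := by ring
    linarith
  refine ⟨?_, ?_, hsq⟩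
  -- The tangent to `y ↦ 1/y` at `t` gives `1/y ≥ 2/t - y/t²`; since the mean is at most `t`,
  -- integration leaves at least `1/t`.
  · set t := 5 / 4 * Λ with ht
    have ht0 : 0 < t := by positivity
    have h3 : ∫ x, (2 / t - 1 / t ^ 2 * f x) ∂P ≤ ∫ x, (1 / f x) ∂P := by
      refine integral_mono ((integrable_const _).sub (hfi.const_mul _)) hi fun x => ?_
      have h4 : 1 / f x - (2 / t - 1 / t ^ 2 * f x) = (f x - t) ^ 2 / (t ^ 2 * f x) := by
        have := (hpos x).ne'
        field_simp
        ring
      have h5 : 0 ≤ (f x - t) ^ 2 / (t ^ 2 * f x) := by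
        have := hpos x
        positivity
      simp only
      linarith
    rw [integral_sub (integrable_const _) (hfi.const_mul _), integral_const_mul (1 / t ^ 2), hμ]
      at h3
    simp only [integral_const, probReal_univ, smul_eq_mul, one_mul] at h3
    have h6 : 1 / t ^ 2 * μ ≤ 1 / t ^ 2 * t := mul_le_mul_of_nonneg_left h2 (by positivity)
    have h7 : 2 / t - 1 / t ^ 2 * t = 4 / 5 / Λ := by rw [ht]; field_simp; norm_num
    linarith
  -- The first moment follows from the second by the arithmetic-geometric mean inequality: `25/16 +
  -- 1/2 = 33/16`.
  · have h3 : ∫ x, (1 / f x) ∂P ≤ ∫ x, (Λ / 2 * (1 / f x) ^ 2 + 1 / (2 * Λ)) ∂P := by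
      refine integral_mono hi ((hi2.const_mul _).add (integrable_const _)) fun x => ?_
      have h4 : Λ / 2 * (1 / f x) ^ 2 + 1 / (2 * Λ) - 1 / f x
          = (Λ * (1 / f x) - 1) ^ 2 / (2 * Λ) := by
        field_simp
        ring
      have h5 : 0 ≤ (Λ * (1 / f x) - 1) ^ 2 / (2 * Λ) := by positivity
      simp only
      linarith
    rw [integral_add (hi2.const_mul _) (integrable_const _), integral_const_mul] at h3
    simp only [integral_const, probReal_univ, smul_eq_mul, one_mul] at h3
    have h6 := mul_le_mul_of_nonneg_left hsq (show 0 ≤ Λ / 2 by positivity)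
    have h7 : Λ / 2 * (25 / 8 / Λ ^ 2) + 1 / (2 * Λ) = 33 / 16 / Λ := by field_simp; norm_num
    have h8 : 33 / 16 / Λ ≤ 207 / 100 / Λ :=
      div_le_div_of_nonneg_right (by norm_num) hΛ.le
    linarith

theorem integral_inv_sampleMean_bounds {X : Type*} [MeasurableSpace X] {ν : Measure X}
    [IsProbabilityMeasure ν] {Y : X → ℝ} (hY : MemLp Y 2 ν) (hY0 : ∀ x, 0 ≤ Y x) {n : ℕ}
    (hn : 0 < n) {b c r Λ V : ℝ} (hc : 0 < c) (hr : 0 ≤ r) (hΛ : 0 < Λ)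
    (h1 : Λ ≤ c + r * ∫ x, Y x ∂ν) (h2 : c + r * ∫ x, Y x ∂ν ≤ 5 / 4 * Λ)
    (hvar : ∫ x, ‖Y x - b‖ ^ 2 ∂ν ≤ V) (hV : r ^ 2 * (V / n) ≤ 9 / 16 * c ^ 2) :
    4 / 5 / Λ ≤ ∫ s : Fin n → X, (1 / (c + r * ((n : ℝ)⁻¹ • ∑ j, Y (s j))))
        ∂(Measure.pi fun _ => ν) ∧
      ∫ s : Fin n → X, (1 / (c + r * ((n : ℝ)⁻¹ • ∑ j, Y (s j)))) ∂(Measure.pi fun _ => ν)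
        ≤ 207 / 100 / Λ ∧
      ∫ s : Fin n → X, (1 / (c + r * ((n : ℝ)⁻¹ • ∑ j, Y (s j)))) ^ 2 ∂(Measure.pi fun _ => ν)
        ≤ 25 / 8 / Λ ^ 2 := by
  have hZ := memLp_sampleMean hY n
  have hZm := integral_sampleMean (hY.integrable one_le_two) hn
  have hZv := (integral_norm_sampleMean_sub_sq_le hY hn b).trans
    (div_le_div_of_nonneg_right hvar (Nat.cast_nonneg _))
  refine integral_inv_bounds (f := fun s : Fin n → X => c + r * ((n : ℝ)⁻¹ • ∑ j, Y (s j)))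
    ((memLp_const c).add (hZ.const_mul r)) hc (fun s => ?_) ?_ hΛ h1 h2 ?_
  · have : 0 ≤ (n : ℝ)⁻¹ • ∑ j, Y (s j) :=
      smul_nonneg (by positivity) (Finset.sum_nonneg fun j _ => hY0 _)
    exact le_add_of_nonneg_right (mul_nonneg hr this)
  · rw [integral_add (integrable_const _) ((hZ.integrable one_le_two).const_mul r),
      integral_const_mul r, hZm]
    simp
  · have h3 : ∀ s : Fin n → X,
        ‖c + r * ((n : ℝ)⁻¹ • ∑ j, Y (s j)) - (c + r * ∫ x, Y x ∂ν)‖ ^ 2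
          = r ^ 2 * ‖(n : ℝ)⁻¹ • ∑ j, Y (s j) - ∫ x, Y x ∂ν‖ ^ 2 := fun s => by
      rw [Real.norm_eq_abs, sq_abs, Real.norm_eq_abs, sq_abs]; ring
    simp_rw [h3]
    rw [integral_const_mul]
    exact (mul_le_mul_of_nonneg_left hZv (sq_nonneg r)).trans hV

namespace Assumptions

variable {d : ℕ} {I Θ : Type*} [MeasurableSpace I] [Countable I] [DiscreteMeasurableSpace I]
  [MeasurableSpace Θ] {p : Measure I} [IsProbabilityMeasure p] {D : I → Measure Θ}
  [∀ i, IsProbabilityMeasure (D i)]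
  {ℓ : I → Param d → Θ → ℝ} {L ρ σ σt α : ℝ} {B Din Do B' Dβ : ℕ}

theorem betaTilde_nonneg (H : Assumptions p D ℓ L ρ σ σt α) (w : Param d)
    (T : Fin B' → StepDraw I Θ Dβ) : 0 ≤ betaTilde ℓ L ρ α w T := by
  have := H.L_pos; have := H.rho_nonneg; have := H.alpha_nonneg
  rw [betaTilde]; positivity

theorem betaTilde_le (H : Assumptions p D ℓ L ρ σ σt α) (w : Param d)
    (T : Fin B' → StepDraw I Θ Dβ) : betaTilde ℓ L ρ α w T ≤ 1 / (4 * L) := by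
  have := H.L_pos; have := H.rho_nonneg; have := H.alpha_nonneg
  rw [betaTilde]
  refine one_div_le_one_div_of_le (by positivity) (le_add_of_nonneg_right (by positivity))

theorem measurable_betaTilde (H : Assumptions p D ℓ L ρ σ σt α) {X : Type*} [MeasurableSpace X]
    {w : X → Param d} {T : X → Fin B' → StepDraw I Θ Dβ} (hw : Measurable w)
    (hT : Measurable T) : Measurable fun x => betaTilde ℓ L ρ α (w x) (T x) := by
  have h1 : ∀ j, Measurable fun x => T x j := fun j => (measurable_pi_apply j).comp hT
  refine ((((Finset.measurable_fun_sum Finset.univ fun j _ => ?_).const_mul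
    (2 * ρ * α)).div_const (B' : ℝ)).const_add (4 * L)).const_div 1
  exact (H.measurable_batchGrad (measurable_fst.comp (h1 j)) hw
    (measurable_snd.comp (h1 j))).norm

/-- This is the role of the two ceilings. The first bound keeps the mean denominator of `β̃` below
`Λ + L ≤ 5Λ/4`. In the second, tasks contribute `8L²` and data at most `L²`, and `9L² = (9/16)(4L)²`
is the variance allowed in `integral_inv_bounds` with `c = 4L`. -/
theorem batch_noise_le (H : Assumptions p D ℓ L ρ σ σt α) (hB' : 0 < B') (hβ : 0 < Dβ)
    (h1 : ⌈(1 / 2) * (ρ * α * σ / L) ^ 2⌉₊ ≤ B') (h2 : ⌈(2 * ρ * α * σt / L) ^ 2⌉₊ ≤ Dβ) :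
    2 * (ρ * α) * (σt / √Dβ) ≤ L ∧
      (2 * (ρ * α)) ^ 2 * ((σt ^ 2 / Dβ + σ ^ 2) / B') ≤ 9 * L ^ 2 := by
  have hL := H.L_pos
  have hBr : (1 : ℝ) ≤ B' := by exact_mod_cast hB'
  have hDr : (0 : ℝ) < Dβ := by exact_mod_cast hβ
  have h1' : (ρ * α * σ) ^ 2 ≤ 2 * B' * L ^ 2 := by
    have := (Nat.le_ceil _).trans (Nat.cast_le (α := ℝ).2 h1)
    rw [div_pow, ← mul_div_assoc, div_le_iff₀ (by positivity)] at this
    linarith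
  have h2' : (2 * (ρ * α) * σt) ^ 2 ≤ Dβ * L ^ 2 := by
    have := (Nat.le_ceil _).trans (Nat.cast_le (α := ℝ).2 h2)
    rw [div_pow, div_le_iff₀ (by positivity)] at this
    linarith
  constructor
  · rw [← mul_div_assoc, div_le_iff₀ (Real.sqrt_pos.2 hDr)]
    refine abs_le_of_sq_le_sq' ?_ (by positivity) |>.2
    rw [mul_pow L, Real.sq_sqrt hDr.le]
    linarith
  · rw [← mul_div_assoc, div_le_iff₀ (by positivity), mul_add, ← mul_div_assoc]
    have h3 : (2 * (ρ * α)) ^ 2 * σt ^ 2 / Dβ ≤ L ^ 2 := by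
      rw [div_le_iff₀ hDr]; linarith
    nlinarith [sq_nonneg L]

theorem integral_betaTilde_bounds (H : Assumptions p D ℓ L ρ σ σt α) (hB' : 0 < B') (hβ : 0 < Dβ)
    (h1 : ⌈(1 / 2) * (ρ * α * σ / L) ^ 2⌉₊ ≤ B') (h2 : ⌈(2 * ρ * α * σt / L) ^ 2⌉₊ ≤ Dβ)
    (w : Param d) :
    4 / 5 / localSmoothness p D ℓ L ρ α w
        ≤ ∫ T : Fin B' → StepDraw I Θ Dβ, betaTilde ℓ L ρ α w T
          ∂(Measure.pi fun _ => stepLaw p D Dβ) ∧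
      ∫ T : Fin B' → StepDraw I Θ Dβ, betaTilde ℓ L ρ α w T ∂(Measure.pi fun _ => stepLaw p D Dβ)
        ≤ 207 / 100 / localSmoothness p D ℓ L ρ α w ∧
      ∫ T : Fin B' → StepDraw I Θ Dβ, betaTilde ℓ L ρ α w T ^ 2
        ∂(Measure.pi fun _ => stepLaw p D Dβ) ≤ 25 / 8 / localSmoothness p D ℓ L ρ α w ^ 2 := by
  obtain ⟨hn1, hn2⟩ := H.batch_noise_le hB' hβ h1 h2
  have hL := H.L_pos
  have hρα : 0 ≤ 2 * (ρ * α) := by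
    have := mul_nonneg H.rho_nonneg H.alpha_nonneg; linarith
  obtain ⟨hY, hvar⟩ := H.memLp_batchGrad_stepLaw hβ w
  obtain ⟨hM1, hM2⟩ := H.integral_norm_batchGrad_stepLaw hβ w
  -- Taking norms does not increase the mean square deviation, by the reverse triangle inequality.
  have hYv : ∫ T : StepDraw I Θ Dβ, ‖‖batchGrad ℓ T.1 w T.2‖ - ‖∇ (meanLoss p D ℓ) w‖‖ ^ 2
      ∂(stepLaw p D Dβ) ≤ σt ^ 2 / Dβ + σ ^ 2 :=
    le_trans (integral_mono (MemLp.integrable_norm_sub_sq hY.norm ‖∇ (meanLoss p D ℓ) w‖)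
      (MemLp.integrable_norm_sub_sq hY (∇ (meanLoss p D ℓ) w)) fun T =>
        pow_le_pow_left₀ (norm_nonneg _) (abs_norm_sub_norm_le _ _) 2) hvar
  have h3 := mul_le_mul_of_nonneg_left hM1 hρα
  have h4 := mul_le_mul_of_nonneg_left hM2 hρα
  have h5 := H.four_mul_le_localSmoothness w
  have h6 : localSmoothness p D ℓ L ρ α w = 4 * L + 2 * (ρ * α) * meanGradNorm p D ℓ w := rfl
  have key := integral_inv_sampleMean_bounds (c := 4 * L) hY.norm (fun _ => norm_nonneg _) hB'
    (by positivity) hρα (H.localSmoothness_pos w) (by linarith) (by linarith) hYv (by linarith)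
  have hbeta : ∀ T : Fin B' → StepDraw I Θ Dβ, betaTilde ℓ L ρ α w T
      = 1 / (4 * L + 2 * (ρ * α) * ((B' : ℝ)⁻¹ • ∑ j, ‖batchGrad ℓ (T j).1 w (T j).2‖)) :=
    fun T => by
      simp only [betaTilde, smul_eq_mul]
      congr 2
      ring
  simp_rw [hbeta]
  exact key

end Assumptions

end FOMAML

/-! ### Expected decrease in one iteration. -/

namespace FOMAML

section RandomStep

variable {X Y E : Type*} [MeasurableSpace X] [MeasurableSpace Y] {μ : Measure X}
  [IsProbabilityMeasure μ] {ν : Measure Y} [IsProbabilityMeasure ν] [NormedAddCommGroup E]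
  [InnerProductSpace ℝ E] {G : X → E} {b : Y → ℝ} {b₀ : ℝ}

theorem memLp_smul_prod (hG : MemLp G 2 μ) (hb : Measurable b) (hb0 : ∀ y, 0 ≤ b y)
    (hbb : ∀ y, b y ≤ b₀) : MemLp (fun z : X × Y => b z.2 • G z.1) 2 (μ.prod ν) := by
  have h1 : MemLp (fun z : X × Y => G z.1) 2 (μ.prod ν) :=
    hG.comp_measurePreserving measurePreserving_fst
  refine (h1.const_smul b₀).mono
    ((hb.comp measurable_snd).aestronglyMeasurable.smul h1.1) ?_
  refine Filter.Eventually.of_forall fun z => ?_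
  simp only [Pi.smul_apply, norm_smul]
  refine mul_le_mul_of_nonneg_right ?_ (norm_nonneg _)
  rw [Real.norm_of_nonneg (hb0 _)]
  exact (hbb _).trans (le_abs_self _)

theorem integral_norm_sub_smul_prod_sq_le (hG : MemLp G 2 μ) (hb : Measurable b)
    (hb0 : ∀ y, 0 ≤ b y) (hbb : ∀ y, b y ≤ b₀) (w : E) :
    ∫ z, ‖w - b z.2 • G z.1‖ ^ 2 ∂(μ.prod ν)
      ≤ 2 * ‖w‖ ^ 2 + 2 * b₀ ^ 2 * ∫ x, ‖G x‖ ^ 2 ∂μ := by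
  have h1 : MemLp (fun z : X × Y => G z.1) 2 (μ.prod ν) :=
    hG.comp_measurePreserving measurePreserving_fst
  have h2 : Integrable (fun z : X × Y => ‖G z.1‖ ^ 2) (μ.prod ν) :=
    h1.integrable_norm_pow two_ne_zero
  have h3 : MemLp (fun z : X × Y => w - b z.2 • G z.1) 2 (μ.prod ν) :=
    (memLp_const w).sub (memLp_smul_prod hG hb hb0 hbb)
  have h4 : ∫ z : X × Y, ‖G z.1‖ ^ 2 ∂(μ.prod ν) = ∫ x, ‖G x‖ ^ 2 ∂μ := by
    have := integral_fun_fst (μ := μ) (ν := ν) (fun x => ‖G x‖ ^ 2)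
    simpa using this
  refine (integral_mono (h3.integrable_norm_pow two_ne_zero)
    ((integrable_const (2 * ‖w‖ ^ 2)).add (h2.const_mul (2 * b₀ ^ 2))) fun z => ?_).trans ?_
  · have h5 : ‖w - b z.2 • G z.1‖ ≤ ‖w‖ + b₀ * ‖G z.1‖ := by
      refine (norm_sub_le _ _).trans (add_le_add le_rfl ?_)
      rw [norm_smul, Real.norm_of_nonneg (hb0 _)]
      exact mul_le_mul_of_nonneg_right (hbb _) (norm_nonneg _)
    have h6 := pow_le_pow_left₀ (norm_nonneg _) h5 2
    simp only [Pi.add_apply]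
    nlinarith [sq_nonneg (‖w‖ - b₀ * ‖G z.1‖)]
  · simp only [Pi.add_apply]
    rw [integral_add (integrable_const _) (h2.const_mul _), integral_const_mul (2 * b₀ ^ 2), h4]
    simp

/-- Integrate the quadratic expansion at `w`; independence of `b` and `G` factors both the linear
and the quadratic term. The expansion also bounds `F` by integrable functions. -/
theorem integral_comp_sub_smul_prod_le [MeasurableSpace E] [BorelSpace E] {F : E → ℝ}
    (hF : Continuous F) {g w : E} {K : ℝ}
    (hK : ∀ u, |F u - F w - inner ℝ g (u - w)| ≤ K * ‖u - w‖ ^ 2) (hG : MemLp G 2 μ)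
    (hb : Measurable b) (hb0 : ∀ y, 0 ≤ b y) (hbb : ∀ y, b y ≤ b₀) :
    Integrable (fun z : X × Y => F (w - b z.2 • G z.1)) (μ.prod ν) ∧
    ∫ z, F (w - b z.2 • G z.1) ∂(μ.prod ν)
      ≤ F w - (∫ y, b y ∂ν) * (∫ x, inner ℝ g (G x) ∂μ)
        + K * ((∫ y, b y ^ 2 ∂ν) * ∫ x, ‖G x‖ ^ 2 ∂μ) := by
  have hbm : MemLp b 2 ν := MemLp.of_bound hb.aestronglyMeasurable b₀
    (Filter.Eventually.of_forall fun y => by rw [Real.norm_of_nonneg (hb0 y)]; exact hbb y)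
  have hi1 : Integrable (fun z : X × Y => inner ℝ g (G z.1) * b z.2) (μ.prod ν) :=
    Integrable.mul_prod ((hG.integrable one_le_two).const_inner g) (hbm.integrable one_le_two)
  have hi2 : Integrable (fun z : X × Y => ‖G z.1‖ ^ 2 * b z.2 ^ 2) (μ.prod ν) :=
    Integrable.mul_prod (hG.integrable_norm_pow two_ne_zero) hbm.integrable_sq
  have hpt : ∀ z : X × Y, |F (w - b z.2 • G z.1) - F w + inner ℝ g (G z.1) * b z.2|
      ≤ K * (‖G z.1‖ ^ 2 * b z.2 ^ 2) := fun z => by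
    have h1 := hK (w - b z.2 • G z.1)
    rw [sub_sub_cancel_left, inner_neg_right, inner_smul_right, norm_neg, norm_smul, mul_pow,
      Real.norm_eq_abs, sq_abs] at h1
    calc _ = |F (w - b z.2 • G z.1) - F w - -(b z.2 * inner ℝ g (G z.1))| := by ring_nf
      _ ≤ _ := h1
      _ = _ := by ring
  have hi3 : Integrable (fun z : X × Y => F w - inner ℝ g (G z.1) * b z.2) (μ.prod ν) :=
    (integrable_const _).sub hi1
  have hm : AEStronglyMeasurable (fun z : X × Y => F (w - b z.2 • G z.1)) (μ.prod ν) :=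
    hF.comp_aestronglyMeasurable
      (aestronglyMeasurable_const.sub (memLp_smul_prod hG hb hb0 hbb).1)
  have hint : Integrable (fun z : X × Y => F (w - b z.2 • G z.1)) (μ.prod ν) := by
    have h2 : Integrable (fun z : X × Y =>
        F (w - b z.2 • G z.1) - (F w - inner ℝ g (G z.1) * b z.2)) (μ.prod ν) := by
      refine (hi2.const_mul K).mono' (hm.sub hi3.1) (Filter.Eventually.of_forall fun z => ?_)
      rw [Real.norm_eq_abs]
      calc _ = |F (w - b z.2 • G z.1) - F w + inner ℝ g (G z.1) * b z.2| := by ring_nf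
        _ ≤ _ := hpt z
    refine (h2.add hi3).congr (Filter.Eventually.of_forall fun z => ?_)
    simp
  refine ⟨hint, (integral_mono hint (hi3.add (hi2.const_mul K)) fun z => ?_).trans_eq ?_⟩
  · have := (abs_le.1 (hpt z)).2
    simp only [Pi.add_apply]
    linarith
  · simp only [Pi.add_apply]
    rw [integral_add hi3 (hi2.const_mul K), integral_sub (integrable_const _) hi1,
      integral_const_mul, integral_prod_mul (fun x => inner ℝ g (G x)) b,
      integral_prod_mul (fun x => ‖G x‖ ^ 2) (fun y => b y ^ 2)]
    simp only [integral_const, probReal_univ, smul_eq_mul, one_mul]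
    ring

end RandomStep

namespace Assumptions

variable {d : ℕ} {I Θ : Type*} [MeasurableSpace I] [Countable I] [DiscreteMeasurableSpace I]
  [MeasurableSpace Θ] {p : Measure I} [IsProbabilityMeasure p] {D : I → Measure Θ}
  [∀ i, IsProbabilityMeasure (D i)]
  {ℓ : I → Param d → Θ → ℝ} {L ρ σ σt α : ℝ} {B Din Do B' Dβ : ℕ}

theorem continuous_metaLoss (H : Assumptions p D ℓ L ρ σ σt α) : Continuous (metaLoss p D ℓ α) :=
  continuous_iff_continuousAt.2 fun w => (H.hasGradientAt_metaLoss w).continuousAt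

theorem measurable_foStep (H : Assumptions p D ℓ L ρ σ σt α) :
    Measurable fun z : Param d × Draw I Θ B Din Do B' Dβ => foStep ℓ L ρ α z.1 z.2 := by
  simp_rw [foStep_eq]
  have h1 : ∀ j, Measurable fun z : Param d × Draw I Θ B Din Do B' Dβ => z.2.1 j :=
    fun j => (measurable_pi_apply j).comp (measurable_fst.comp measurable_snd)
  refine measurable_fst.sub (((H.measurable_betaTilde measurable_fst
    (measurable_snd.comp measurable_snd)).div_const 18).smul ?_)
  exact (Finset.measurable_fun_sum _ fun j _ =>
    H.measurable_updateGrad measurable_fst (h1 j)).const_smul (B : ℝ)⁻¹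

/-- The divisor 18 makes the linear gain beat the quadratic loss. In units of `x²/Λ` the gain is
`0.8 · 0.61 / 18 > 0.027` and the loss is `0.55 · (25/8) · 2.7 / 324 < 0.015`, leaving more than
`1/100`. The noise terms add up to less than `1` in units of `n/Λ`. -/
theorem integral_metaLoss_foStep_le (H : Assumptions p D ℓ L ρ σ σt α) (hB : 20 ≤ B)
    (hin : 0 < Din) (ho : 0 < Do) (hB' : 0 < B') (hβ : 0 < Dβ)
    (h1 : ⌈(1 / 2) * (ρ * α * σ / L) ^ 2⌉₊ ≤ B') (h2 : ⌈(2 * ρ * α * σt / L) ^ 2⌉₊ ≤ Dβ)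
    (w : Param d) :
    ∫ s, metaLoss p D ℓ α (foStep ℓ L ρ α w s) ∂(drawLaw p D B Din Do B' Dβ)
      ≤ metaLoss p D ℓ α w
        - (‖∇ (metaLoss p D ℓ α) w‖ ^ 2 / 100 - noiseSq L σ σt α B Din Do)
          / localSmoothness p D ℓ L ρ α w := by
  have hb : Measurable fun T : Fin B' → StepDraw I Θ Dβ => betaTilde ℓ L ρ α w T / 18 :=
    (H.measurable_betaTilde measurable_const measurable_id).div_const 18
  have key := (integral_comp_sub_smul_prod_le
    (ν := Measure.pi fun _ : Fin B' => stepLaw p D Dβ) H.continuous_metaLoss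
    (H.abs_metaLoss_sub_sub_inner_le w)
    (H.memLp_meanUpdate (B := B) (Din := Din) (Do := Do) hin ho w) hb
    (fun T => div_nonneg (H.betaTilde_nonneg w T) (by norm_num))
    (fun T => div_le_div_of_nonneg_right (H.betaTilde_le w T) (by norm_num))).2
  simp_rw [foStep_eq]
  refine key.trans ?_
  have hG1 := H.le_inner_integral_meanUpdate (B := B) (by omega) hin ho w
  have hG2 := H.integral_norm_meanUpdate_sq_le hB hin ho w
  obtain ⟨hb1, hb2, hb3⟩ := H.integral_betaTilde_bounds hB' hβ h1 h2 w
  have he := noiseSq_nonneg L σ σt α B Din Do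
  simp_rw [div_pow]
  rw [integral_div, integral_div]
  have hG0 : 0 ≤ ∫ s, ‖meanUpdate (B := B) ℓ α w s‖ ^ 2
      ∂(Measure.pi fun _ => updateLaw p D Din Do) := integral_nonneg fun _ => sq_nonneg _
  set J := ∫ s, inner ℝ (∇ (metaLoss p D ℓ α) w) (meanUpdate (B := B) ℓ α w s)
        ∂(Measure.pi fun _ => updateLaw p D Din Do)
  set Q := ∫ s, ‖meanUpdate (B := B) ℓ α w s‖ ^ 2 ∂(Measure.pi fun _ => updateLaw p D Din Do)
  set b1 := ∫ T : Fin B' → StepDraw I Θ Dβ, betaTilde ℓ L ρ α w T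
          ∂(Measure.pi fun _ => stepLaw p D Dβ)
  set b2 := ∫ T : Fin B' → StepDraw I Θ Dβ, betaTilde ℓ L ρ α w T ^ 2
        ∂(Measure.pi fun _ => stepLaw p D Dβ)
  set x := ‖∇ (metaLoss p D ℓ α) w‖
  set e := noiseSq L σ σt α B Din Do
  have hΛ := H.localSmoothness_pos w
  set Λ := localSmoothness p D ℓ L ρ α w
  have hb0 : 0 ≤ b1 := le_trans (by positivity) hb1
  have c1 : b1 * (61 / 100 * x ^ 2 - 4 * e) ≤ b1 * J := mul_le_mul_of_nonneg_left hG1 hb0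
  have c2 : 4 / 5 / Λ * x ^ 2 ≤ b1 * x ^ 2 := mul_le_mul_of_nonneg_right hb1 (sq_nonneg _)
  have c3 : b1 * e ≤ 207 / 100 / Λ * e := mul_le_mul_of_nonneg_right hb2 he
  have c4 : b2 * Q ≤ 25 / 8 / Λ ^ 2 * (27 / 10 * x ^ 2 + 14 * e) :=
    mul_le_mul hb3 hG2 hG0 (by positivity)
  have c5 := mul_le_mul_of_nonneg_left c4 (show 0 ≤ 55 / 100 * Λ / 324 by positivity)
  have c6 : 55 / 100 * Λ / 324 * (25 / 8 / Λ ^ 2 * (27 / 10 * x ^ 2 + 14 * e))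
      = 55 / 100 * 25 / 8 / 324 * (27 / 10 * (x ^ 2 / Λ) + 14 * (e / Λ)) := by
    field_simp
  have c7 : (x ^ 2 / 100 - e) / Λ = x ^ 2 / Λ / 100 - e / Λ := by ring
  have c8 : 4 / 5 / Λ * x ^ 2 = 4 / 5 * (x ^ 2 / Λ) := by ring
  have c9 : 207 / 100 / Λ * e = 207 / 100 * (e / Λ) := by ring
  have c10 : 0 ≤ x ^ 2 / Λ := by positivity
  have c11 : 0 ≤ e / Λ := by positivity
  rw [c6] at c5
  rw [c7]
  rw [c8] at c2
  rw [c9] at c3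
  have c12 : 55 / 100 * Λ * (b2 / 18 ^ 2 * Q) = 55 / 100 * Λ / 324 * (b2 * Q) := by ring
  have c13 : b1 / 18 * J = b1 * J / 18 := by ring
  have c14 : b1 * (61 / 100 * x ^ 2 - 4 * e) = 61 / 100 * (b1 * x ^ 2) - 4 * (b1 * e) := by ring
  rw [c12, c13]
  rw [c14] at c1
  linarith

/-- The expansion at the origin gives polynomial growth. It serves only integrability along the
iterates; the size of `A` does not enter the rate. -/
theorem norm_gradient_metaLoss_le_linear (H : Assumptions p D ℓ L ρ σ σt α) :
    ∃ A : ℝ, 0 ≤ A ∧ ∀ w, ‖∇ (metaLoss p D ℓ α) w‖ ≤ A * (1 + ‖w‖) ∧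
      |metaLoss p D ℓ α w| ≤ A * (1 + ‖w‖ ^ 2) := by
  have hK := H.localSmoothness_pos 0
  set K := localSmoothness p D ℓ L ρ α 0
  set g := ∇ (metaLoss p D ℓ α) 0
  refine ⟨K + ‖g‖ + |metaLoss p D ℓ α 0|, by positivity, fun w => ⟨?_, ?_⟩⟩
  · have h1 := H.norm_gradient_metaLoss_sub_le 0 w
    rw [sub_zero] at h1
    have h2 := norm_le_norm_sub_add (∇ (metaLoss p D ℓ α) w) g
    have h3 := mul_nonneg hK.le (norm_nonneg w)
    have h4 := mul_nonneg (norm_nonneg g) (norm_nonneg w)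
    have h5 := mul_nonneg (abs_nonneg (metaLoss p D ℓ α 0)) (norm_nonneg w)
    have h6 := abs_nonneg (metaLoss p D ℓ α 0)
    change ‖∇ (metaLoss p D ℓ α) w - g‖ ≤ 55 / 100 * K * ‖w‖ at h1
    linarith
  · have h1 := H.abs_metaLoss_sub_sub_inner_le 0 w
    rw [sub_zero] at h1
    change |metaLoss p D ℓ α w - metaLoss p D ℓ α 0 - inner ℝ g w| ≤ 55 / 100 * K * ‖w‖ ^ 2 at h1
    have h2 := abs_real_inner_le_norm g w
    have h3 := abs_nonneg (metaLoss p D ℓ α 0)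
    have h4 := mul_nonneg hK.le (sq_nonneg ‖w‖)
    have h5 := mul_nonneg h3 (sq_nonneg ‖w‖)
    have h6 : ‖g‖ * ‖w‖ ≤ ‖g‖ * (1 + ‖w‖ ^ 2) :=
      mul_le_mul_of_nonneg_left (by nlinarith [sq_nonneg (‖w‖ - 1), norm_nonneg w]) (norm_nonneg g)
    have h7 : |metaLoss p D ℓ α w| ≤ |metaLoss p D ℓ α w - metaLoss p D ℓ α 0 - inner ℝ g w|
        + |metaLoss p D ℓ α 0| + |inner ℝ g w| := by
      have := abs_add_three (metaLoss p D ℓ α w - metaLoss p D ℓ α 0 - inner ℝ g w)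
        (metaLoss p D ℓ α 0) (inner ℝ g w)
      rwa [show metaLoss p D ℓ α w - metaLoss p D ℓ α 0 - inner ℝ g w + metaLoss p D ℓ α 0
        + inner ℝ g w = metaLoss p D ℓ α w by ring] at this
    linarith

theorem integral_norm_foStep_sq_le (H : Assumptions p D ℓ L ρ σ σt α) (hB : 20 ≤ B)
    (hin : 0 < Din) (ho : 0 < Do) :
    ∃ A : ℝ, 0 ≤ A ∧ ∀ w, MemLp (foStep ℓ L ρ α w) 2 (drawLaw p D B Din Do B' Dβ) ∧
      ∫ s, ‖foStep ℓ L ρ α w s‖ ^ 2 ∂(drawLaw p D B Din Do B' Dβ) ≤ A * (1 + ‖w‖ ^ 2) := by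
  obtain ⟨A, hA0, hA⟩ := H.norm_gradient_metaLoss_le_linear
  have he := noiseSq_nonneg L σ σt α B Din Do
  set e := noiseSq L σ σt α B Din Do with he'
  set b₀ : ℝ := 1 / (4 * L) / 18
  refine ⟨2 + 2 * b₀ ^ 2 * (6 * A ^ 2 + 14 * e), by positivity, fun w => ?_⟩
  have hb : Measurable fun T : Fin B' → StepDraw I Θ Dβ => betaTilde ℓ L ρ α w T / 18 :=
    (H.measurable_betaTilde measurable_const measurable_id).div_const 18
  have hb0 : ∀ T : Fin B' → StepDraw I Θ Dβ, 0 ≤ betaTilde ℓ L ρ α w T / 18 :=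
    fun T => div_nonneg (H.betaTilde_nonneg w T) (by norm_num)
  have hbb : ∀ T : Fin B' → StepDraw I Θ Dβ, betaTilde ℓ L ρ α w T / 18 ≤ b₀ :=
    fun T => div_le_div_of_nonneg_right (H.betaTilde_le w T) (by norm_num)
  have hG := H.memLp_meanUpdate (B := B) (Din := Din) (Do := Do) hin ho w
  have heq : foStep ℓ L ρ α w = fun s : Draw I Θ B Din Do B' Dβ =>
      w - (betaTilde ℓ L ρ α w s.2 / 18) • meanUpdate ℓ α w s.1 :=
    funext fun s => foStep_eq ℓ L ρ α w s
  rw [heq]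
  refine ⟨(memLp_const w).sub (memLp_smul_prod hG hb hb0 hbb),
    (integral_norm_sub_smul_prod_sq_le hG hb hb0 hbb w).trans ?_⟩
  have h1 := H.integral_norm_meanUpdate_sq_le hB hin ho w
  rw [← he'] at h1
  have h2 := pow_le_pow_left₀ (norm_nonneg _) (hA w).1 2
  have h3 : (1 + ‖w‖) ^ 2 ≤ 2 * (1 + ‖w‖ ^ 2) := by nlinarith [sq_nonneg (‖w‖ - 1)]
  have h4 : ‖∇ (metaLoss p D ℓ α) w‖ ^ 2 ≤ 2 * A ^ 2 * (1 + ‖w‖ ^ 2) := by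
    rw [mul_pow] at h2
    have := mul_le_mul_of_nonneg_left h3 (sq_nonneg A)
    linarith
  have h5 : ∫ s, ‖meanUpdate (B := B) ℓ α w s‖ ^ 2 ∂(Measure.pi fun _ => updateLaw p D Din Do)
      ≤ (6 * A ^ 2 + 14 * e) * (1 + ‖w‖ ^ 2) := by
    have h6 := mul_nonneg he (sq_nonneg ‖w‖)
    have h7 := mul_nonneg (sq_nonneg A) (show 0 ≤ 1 + ‖w‖ ^ 2 by positivity)
    linarith
  have h6 := mul_le_mul_of_nonneg_left h5 (show 0 ≤ 2 * b₀ ^ 2 by positivity)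
  linarith

end Assumptions

end FOMAML

/-! ### Laws of the iterates and decrease in expectation. -/

namespace FOMAML

/-- The law of the `k`-th FO-MAML iterate. -/
def iterateLaw {d : ℕ} {I Θ : Type*} [MeasurableSpace I] [Countable I] [DiscreteMeasurableSpace I]
    [MeasurableSpace Θ] (p : Measure I) (D : I → Measure Θ) (ℓ : I → Param d → Θ → ℝ)
    (L ρ α : ℝ) (B Din Do B' Dβ : ℕ) (w₀ : Param d) : ℕ → Measure (Param d)
  | 0 => Measure.dirac w₀
  | k + 1 => ((iterateLaw p D ℓ L ρ α B Din Do B' Dβ w₀ k).prod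
      (drawLaw p D B Din Do B' Dβ)).map fun z => foStep ℓ L ρ α z.1 z.2

namespace Assumptions

variable {d : ℕ} {I Θ : Type*} [MeasurableSpace I] [Countable I] [DiscreteMeasurableSpace I]
  [MeasurableSpace Θ] {p : Measure I} [IsProbabilityMeasure p] {D : I → Measure Θ}
  [∀ i, IsProbabilityMeasure (D i)]
  {ℓ : I → Param d → Θ → ℝ} {L ρ σ σt α : ℝ} {B Din Do B' Dβ : ℕ} {w₀ : Param d}

section Law

variable {Ω : Type*} [mΩ : MeasurableSpace Ω] {P : Measure Ω} [IsProbabilityMeasure P]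
  {S : ℕ → Ω → Draw I Θ B Din Do B' Dβ}

theorem measurable_iterate_iSup_comap (H : Assumptions p D ℓ L ρ σ σt α) (k : ℕ) :
    Measurable[⨆ j ∈ Set.Iio k, MeasurableSpace.comap (S j) inferInstance]
      (iterate ℓ L ρ α S w₀ k) := by
  induction k with
  | zero => exact measurable_const
  | succ k ih =>
    have h1 : Measurable[⨆ j ∈ Set.Iio (k + 1), MeasurableSpace.comap (S j) inferInstance]
        (iterate ℓ L ρ α S w₀ k) :=
      ih.mono (biSup_mono fun j hj => Nat.lt_succ_of_lt hj) le_rfl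
    have h2 : Measurable[⨆ j ∈ Set.Iio (k + 1), MeasurableSpace.comap (S j) inferInstance]
        (S k) :=
      (comap_measurable (S k)).mono
        (le_biSup (fun j => MeasurableSpace.comap (S j) inferInstance)
          (show k ∈ Set.Iio (k + 1) from Nat.lt_succ_self k)) le_rfl
    exact H.measurable_foStep.comp (@Measurable.prodMk _ _ _ _ _ (_) _ _ h1 h2)

/-- The iterate `k` is a function of the draws with index below `k`, hence independent of draw `k`.
-/
theorem indepFun_iterate (H : Assumptions p D ℓ L ρ σ σt α) (hS : ∀ k, Measurable (S k))
    (hind : iIndepFun S P) (k : ℕ) : iterate ℓ L ρ α S w₀ k ⟂ᵢ[P] S k := by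
  have h1 := indep_iSup_of_disjoint (fun j => (hS j).comap_le)
    ((iIndepFun_iff_iIndep _ _ _).1 hind)
    (show Disjoint (Set.Iio k) {k} by simp)
  rw [IndepFun_iff_Indep]
  refine indep_of_indep_of_le_left (indep_of_indep_of_le_right h1 ?_)
    (H.measurable_iterate_iSup_comap k).comap_le
  exact le_biSup (fun j => MeasurableSpace.comap (S j) inferInstance) (Set.mem_singleton k)

theorem measurable_iterate (H : Assumptions p D ℓ L ρ σ σt α) (hS : ∀ k, Measurable (S k))
    (k : ℕ) : Measurable (iterate ℓ L ρ α S w₀ k) :=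
  (H.measurable_iterate_iSup_comap k).mono (iSup₂_le fun j _ => (hS j).comap_le) le_rfl

theorem map_iterate_of_measurable (H : Assumptions p D ℓ L ρ σ σt α) (hS : ∀ k, Measurable (S k))
    (hind : iIndepFun S P) (hlaw : ∀ k, P.map (S k) = drawLaw p D B Din Do B' Dβ) (k : ℕ) :
    P.map (iterate ℓ L ρ α S w₀ k) = iterateLaw p D ℓ L ρ α B Din Do B' Dβ w₀ k := by
  induction k with
  | zero =>
    change P.map (fun _ => w₀) = Measure.dirac w₀
    simp [Measure.map_const]
  | succ k ih =>
    have h1 := (indepFun_iff_map_prod_eq_prod_map_map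
      (H.measurable_iterate (w₀ := w₀) hS k).aemeasurable (hS k).aemeasurable).1
      (H.indepFun_iterate hS hind k)
    rw [ih, hlaw] at h1
    rw [iterateLaw, ← h1, Measure.map_map H.measurable_foStep
      ((H.measurable_iterate hS k).prodMk (hS k))]
    rfl

theorem hasLaw_iterate (H : Assumptions p D ℓ L ρ σ σt α) (hind : iIndepFun S P)
    (hlaw : ∀ k, HasLaw (S k) (drawLaw p D B Din Do B' Dβ) P) (k : ℕ) :
    HasLaw (iterate ℓ L ρ α S w₀ k) (iterateLaw p D ℓ L ρ α B Din Do B' Dβ w₀ k) P := by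
  -- A prescribed law gives only almost everywhere measurable draws. Measurable versions have the
  -- same laws and independence, and their iterates agree almost surely.
  set S' : ℕ → Ω → Draw I Θ B Din Do B' Dβ := fun k => (hlaw k).aemeasurable.mk (S k) with hS'
  have hm : ∀ k, Measurable (S' k) := fun k => (hlaw k).aemeasurable.measurable_mk
  have hae : ∀ k, S k =ᵐ[P] S' k := fun k => (hlaw k).aemeasurable.ae_eq_mk
  have hit : iterate ℓ L ρ α S w₀ k =ᵐ[P] iterate ℓ L ρ α S' w₀ k := by
    clear hS'
    induction k with
    | zero => exact Filter.EventuallyEq.rfl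
    | succ k ih =>
      filter_upwards [ih, hae k] with ω h1 h2
      simp only [iterate, h1, h2]
  have hmap := H.map_iterate_of_measurable (w₀ := w₀) hm (hind.congr hae)
    (fun k => by rw [← Measure.map_congr (hae k)]; exact (hlaw k).map_eq) k
  exact ⟨(H.measurable_iterate hm k).aemeasurable.congr hit.symm,
    by rw [Measure.map_congr hit, hmap]⟩

end Law

section Moments

theorem isProbabilityMeasure_iterateLaw (H : Assumptions p D ℓ L ρ σ σt α) (k : ℕ) :
    IsProbabilityMeasure (iterateLaw p D ℓ L ρ α B Din Do B' Dβ w₀ k) := by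
  induction k with
  | zero => unfold iterateLaw; infer_instance
  | succ k ih =>
    rw [iterateLaw]
    exact Measure.isProbabilityMeasure_map H.measurable_foStep.aemeasurable

theorem integrable_norm_sq_iterateLaw (H : Assumptions p D ℓ L ρ σ σt α) (hB : 20 ≤ B)
    (hin : 0 < Din) (ho : 0 < Do) (k : ℕ) :
    Integrable (fun w => ‖w‖ ^ 2) (iterateLaw p D ℓ L ρ α B Din Do B' Dβ w₀ k) := by
  induction k with
  | zero => exact integrable_dirac (by simp)
  | succ k ih =>
    have := H.isProbabilityMeasure_iterateLaw (B := B) (Din := Din) (Do := Do) (B' := B')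
      (Dβ := Dβ) (w₀ := w₀) k
    obtain ⟨A, -, hA⟩ := H.integral_norm_foStep_sq_le (B' := B') (Dβ := Dβ) hB hin ho
    have hm : Measurable fun w : Param d => ‖w‖ ^ 2 := measurable_norm.pow_const 2
    rw [iterateLaw, integrable_map_measure hm.aestronglyMeasurable
      H.measurable_foStep.aemeasurable]
    refine integrable_prod_of_integral_norm_le
      (hm.comp H.measurable_foStep).aestronglyMeasurable
      (fun w => (hA w).1.integrable_norm_pow two_ne_zero) (fun w => ?_)
      (((integrable_const 1).add ih).const_mul A)
    simpa using (hA w).2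

theorem integrable_metaLoss_of_integrable_norm_sq (H : Assumptions p D ℓ L ρ σ σt α)
    {X : Type*} [MeasurableSpace X] {μ : Measure X} [IsFiniteMeasure μ] {f : X → Param d}
    (hf : AEMeasurable f μ) (hi : Integrable (fun x => ‖f x‖ ^ 2) μ) :
    Integrable (fun x => metaLoss p D ℓ α (f x)) μ := by
  obtain ⟨A, hA0, hA⟩ := H.norm_gradient_metaLoss_le_linear
  exact (((integrable_const 1).add hi).const_mul A).mono'
    (H.continuous_metaLoss.comp_aestronglyMeasurable hf.aestronglyMeasurable)
    (Filter.Eventually.of_forall fun x => (hA (f x)).2)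

theorem integrable_norm_gradient_iterateLaw (H : Assumptions p D ℓ L ρ σ σt α) (hB : 20 ≤ B)
    (hin : 0 < Din) (ho : 0 < Do) (k : ℕ) :
    Integrable (fun w => ‖∇ (metaLoss p D ℓ α) w‖)
      (iterateLaw p D ℓ L ρ α B Din Do B' Dβ w₀ k) := by
  have := H.isProbabilityMeasure_iterateLaw (B := B) (Din := Din) (Do := Do) (B' := B')
    (Dβ := Dβ) (w₀ := w₀) k
  obtain ⟨A, hA0, hA⟩ := H.norm_gradient_metaLoss_le_linear
  refine (((integrable_const 2).add
    (H.integrable_norm_sq_iterateLaw hB hin ho k)).const_mul A).mono'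
    H.continuous_gradient_metaLoss.norm.aestronglyMeasurable
    (Filter.Eventually.of_forall fun w => ?_)
  rw [norm_norm]
  refine (hA w).1.trans (mul_le_mul_of_nonneg_left ?_ hA0)
  simp only [Pi.add_apply]
  nlinarith [sq_nonneg (‖w‖ - 1), norm_nonneg w]

theorem localSmoothness_le (H : Assumptions p D ℓ L ρ σ σt α) {c K : ℝ} (hc : ρ * α / L ≤ c)
    (hK : 4 + 3 * c * (1 + σ) ≤ K) (w : Param d) :
    localSmoothness p D ℓ L ρ α w ≤ K * L * (1 + ‖∇ (metaLoss p D ℓ α) w‖) := by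
  have hL := H.L_pos
  rw [div_le_iff₀ hL] at hc
  have h1 := H.meanGradNorm_le w
  have h0 := meanGradNorm_nonneg (p := p) (D := D) (ℓ := ℓ) w
  set x := ‖∇ (metaLoss p D ℓ α) w‖
  have hx : 0 ≤ x := norm_nonneg _
  have hρα := mul_nonneg H.rho_nonneg H.alpha_nonneg
  have hcL : 0 ≤ c * L := hρα.trans hc
  have h2 : ρ * α * meanGradNorm p D ℓ w ≤ c * L * (127 / 100 * (x + σ)) :=
    mul_le_mul hc h1 h0 hcL
  have h3 : (4 + 3 * c * (1 + σ)) * (L * (1 + x)) ≤ K * (L * (1 + x)) :=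
    mul_le_mul_of_nonneg_right hK (by positivity)
  have h4 := mul_nonneg hcL hx
  have h5 := mul_nonneg hcL H.sigma_nonneg
  have h6 := mul_nonneg h5 hx
  have h7 := mul_nonneg hL.le hx
  rw [localSmoothness]
  nlinarith

theorem integral_metaLoss_iterateLaw_succ_le (H : Assumptions p D ℓ L ρ σ σt α) (hB : 20 ≤ B)
    (hin : 0 < Din) (ho : 0 < Do) (hB' : 0 < B') (hβ : 0 < Dβ)
    (h1 : ⌈(1 / 2) * (ρ * α * σ / L) ^ 2⌉₊ ≤ B') (h2 : ⌈(2 * ρ * α * σt / L) ^ 2⌉₊ ≤ Dβ)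
    {c K M : ℝ} (hc : ρ * α / L ≤ c) (hK : 4 + 3 * c * (1 + σ) ≤ K) (hK0 : 0 < K) (hM : 0 ≤ M)
    (k : ℕ) (hk : M ≤ ∫ w, ‖∇ (metaLoss p D ℓ α) w‖
      ∂(iterateLaw p D ℓ L ρ α B Din Do B' Dβ w₀ k)) :
    ∫ w, metaLoss p D ℓ α w ∂(iterateLaw p D ℓ L ρ α B Din Do B' Dβ w₀ (k + 1))
      ≤ ∫ w, metaLoss p D ℓ α w ∂(iterateLaw p D ℓ L ρ α B Din Do B' Dβ w₀ k)
        - (M ^ 2 / (1 + M) / (100 * K) - noiseSq L σ σt α B Din Do / 4) / L := by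
  have hprob := H.isProbabilityMeasure_iterateLaw (B := B) (Din := Din) (Do := Do) (B' := B')
    (Dβ := Dβ) (w₀ := w₀) k
  have hL := H.L_pos
  have he := noiseSq_nonneg L σ σt α B Din Do
  have hG := H.integrable_norm_gradient_iterateLaw (B' := B') (Dβ := Dβ) (w₀ := w₀) hB hin ho k
  have hsq := H.integrable_norm_sq_iterateLaw (B' := B') (Dβ := Dβ) (w₀ := w₀) hB hin ho k
  have hF := H.integrable_metaLoss_of_integrable_norm_sq aemeasurable_id hsq
  have hsq' := H.integrable_norm_sq_iterateLaw (B' := B') (Dβ := Dβ) (w₀ := w₀) hB hin ho (k + 1)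
  have hm : Measurable fun w : Param d => ‖w‖ ^ 2 := measurable_norm.pow_const 2
  rw [iterateLaw, integrable_map_measure hm.aestronglyMeasurable
      H.measurable_foStep.aemeasurable] at hsq'
  have hFp := H.integrable_metaLoss_of_integrable_norm_sq H.measurable_foStep.aemeasurable hsq'
  rw [iterateLaw, integral_map H.measurable_foStep.aemeasurable
    H.continuous_metaLoss.aestronglyMeasurable]
  set μ := iterateLaw p D ℓ L ρ α B Din Do B' Dβ w₀ k
  set e := noiseSq L σ σt α B Din Do
  -- The derivative of `x²/(1 + x)` at `M`. The tangent line lies below this convex function, so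
  -- integrating it is Jensen's inequality; as `s ≥ 0`, a mean of at least `M` lets the slope term
  -- be dropped.
  set s := (2 * M + M ^ 2) / (1 + M) ^ 2
  have hpt : ∀ w, ∫ z, metaLoss p D ℓ α (foStep ℓ L ρ α w z) ∂(drawLaw p D B Din Do B' Dβ)
      ≤ metaLoss p D ℓ α w - (1 / (100 * K * L) * (M ^ 2 / (1 + M)
        + s * (‖∇ (metaLoss p D ℓ α) w‖ - M)) - e / (4 * L)) := fun w => by
    refine (H.integral_metaLoss_foStep_le hB hin ho hB' hβ h1 h2 w).trans ?_
    have g1 := H.localSmoothness_le hc hK w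
    have g2 := H.four_mul_le_localSmoothness w
    have g3 := H.localSmoothness_pos w
    set Λ := localSmoothness p D ℓ L ρ α w
    set x := ‖∇ (metaLoss p D ℓ α) w‖
    have hx : 0 ≤ x := norm_nonneg _
    have g4 : e / Λ ≤ e / (4 * L) := div_le_div_of_nonneg_left he (by positivity) g2
    have g5 : x ^ 2 / (K * L * (1 + x)) ≤ x ^ 2 / Λ :=
      div_le_div_of_nonneg_left (sq_nonneg x) g3 g1
    have g6 : x ^ 2 / (1 + x) - (M ^ 2 / (1 + M) + s * (x - M))
        = (x - M) ^ 2 / ((1 + x) * (1 + M) ^ 2) := by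
      simp only [s]
      field_simp
      ring
    have g7 : 0 ≤ (x - M) ^ 2 / ((1 + x) * (1 + M) ^ 2) := by positivity
    have g8 : 1 / (100 * K * L) * (M ^ 2 / (1 + M) + s * (x - M))
        ≤ 1 / (100 * K * L) * (x ^ 2 / (1 + x)) :=
      mul_le_mul_of_nonneg_left (by linarith) (by positivity)
    have g9 : 1 / (100 * K * L) * (x ^ 2 / (1 + x)) = x ^ 2 / (K * L * (1 + x)) / 100 := by
      field_simp
    have g10 : (x ^ 2 / 100 - e) / Λ = x ^ 2 / Λ / 100 - e / Λ := by ring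
    rw [g10]
    linarith
  have hx1 : Integrable (fun w => ‖∇ (metaLoss p D ℓ α) w‖ - M) μ := hG.sub (integrable_const M)
  have hx2 : Integrable (fun w => M ^ 2 / (1 + M) + s * (‖∇ (metaLoss p D ℓ α) w‖ - M)) μ :=
    (integrable_const _).add (hx1.const_mul s)
  have hx3 : Integrable (fun w => 1 / (100 * K * L) * (M ^ 2 / (1 + M)
        + s * (‖∇ (metaLoss p D ℓ α) w‖ - M)) - e / (4 * L)) μ :=
    (hx2.const_mul _).sub (integrable_const _)
  refine (integral_prod_le hFp hpt (hF.sub hx3)).trans ?_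
  simp only [id] at hF ⊢
  rw [integral_sub hF hx3, integral_sub (hx2.const_mul _) (integrable_const _),
    integral_const_mul (1 / (100 * K * L)), integral_add (integrable_const _) (hx1.const_mul s),
    integral_const_mul s, integral_sub hG (integrable_const M)]
  simp only [integral_const, probReal_univ, smul_eq_mul, one_mul]
  have hs : 0 ≤ s := by positivity
  have f1 := mul_nonneg hs (sub_nonneg.2 hk)
  have f2 := mul_nonneg (show 0 ≤ 1 / (100 * K * L) by positivity) f1
  have f3 : (M ^ 2 / (1 + M) / (100 * K) - e / 4) / L
      = 1 / (100 * K * L) * (M ^ 2 / (1 + M)) - e / (4 * L) := by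
    field_simp
  rw [f3]
  linarith

end Moments

end Assumptions

end FOMAML

/-! ### Stopping argument and constants. -/

namespace FOMAML

theorem noiseSq_le {L σ σt α c₂ : ℝ} {B Din Do : ℕ} (hL : 0 ≤ L) (hα : 0 ≤ α)
    (hαL : α * L ≤ 1 / 10) (hc : σ ^ 2 + σt ^ 2 ≤ c₂) (hB : 20 ≤ B) (hin : 0 < Din)
    (ho : 0 < Do) : noiseSq L σ σt α B Din Do ≤ 2 * c₂ := by
  have hBr : (20 : ℝ) ≤ B := by exact_mod_cast hB
  have hir : (1 : ℝ) ≤ Din := by exact_mod_cast hin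
  have hor : (1 : ℝ) ≤ Do := by exact_mod_cast ho
  have h1 : α ^ 2 * L ^ 2 ≤ 1 / 100 := by
    have := pow_le_pow_left₀ (mul_nonneg hα hL) hαL 2
    rw [mul_pow] at this
    linarith
  have h2 : (1 : ℝ) / B ≤ 1 / 20 := one_div_le_one_div_of_le (by norm_num) hBr
  have h3 : σ ^ 2 * (α ^ 2 * L ^ 2 + 1 / B) ≤ σ ^ 2 * (1 / 100 + 1 / 20) :=
    mul_le_mul_of_nonneg_left (add_le_add h1 h2) (sq_nonneg σ)
  have h4 : σt ^ 2 / (B * Do) ≤ σt ^ 2 :=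
    div_le_self (sq_nonneg _) (by nlinarith)
  have h5 : σt ^ 2 / Din ≤ σt ^ 2 := div_le_self (sq_nonneg _) hir
  rw [noiseSq]
  linarith [sq_nonneg σ, sq_nonneg σt]

/-- If each of the first `N` steps decreases a sequence bounded below by at least `δ`, then
`N δ` is at most the initial gap. -/
theorem nat_mul_le_of_descent {F : ℕ → ℝ} {b δ : ℝ} (hb : ∀ k, b ≤ F k) {N : ℕ}
    (h : ∀ k < N, F (k + 1) ≤ F k - δ) : N * δ ≤ F 0 - b := by
  have h1 : ∀ k ≤ N, F k ≤ F 0 - k * δ := by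
    intro k
    induction k with
    | zero => simp
    | succ k ih =>
      intro hk
      have := h k hk
      have := ih (by omega)
      push_cast
      linarith
  linarith [h1 N le_rfl, hb N]

/-- Perpetual descent would contradict the lower bound, so some index has `g ≤ M`. Before the first
such index every step descends, which bounds it. -/
theorem exists_first_of_descent {F g : ℕ → ℝ} {b δ M : ℝ} (hδ : 0 < δ) (hb : ∀ k, b ≤ F k)
    (h : ∀ k, M ≤ g k → F (k + 1) ≤ F k - δ) : ∃ k : ℕ, k * δ ≤ F 0 - b ∧ g k ≤ M := by
  have hex : ∃ k, g k ≤ M := by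
    by_contra! hcon
    obtain ⟨N, hN⟩ := exists_nat_gt ((F 0 - b) / δ)
    rw [div_lt_iff₀ hδ] at hN
    exact absurd (nat_mul_le_of_descent hb fun k (_ : k < N) => h k (hcon k).le) (not_le.2 hN)
  classical
  refine ⟨Nat.find hex, nat_mul_le_of_descent hb fun k hk => h k ?_, Nat.find_spec hex⟩
  exact (not_le.1 (Nat.find_min hex hk)).le

/-- The decrease guaranteed by one step while the mean gradient norm exceeds `C₁ e + ε`. -/
theorem le_descent_amount {C₁ K m e ε : ℝ} (hK : 0 < K) (hm : 0 ≤ m) (hC : 125 * K * (2 + m) = C₁)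
    (hC1 : 1 ≤ C₁) (he : 0 ≤ e) (hem : e ≤ m) (hε : 0 < ε) (hε1 : ε < 1) :
    e ^ 2 + ε ^ 2 / (100 * K * (2 + C₁ * m))
      ≤ (C₁ * e + ε) ^ 2 / (1 + (C₁ * e + ε)) / (100 * K) - e ^ 2 / 4 := by
  have h0 : 0 ≤ C₁ * e := by positivity
  have h1 : 1 + (C₁ * e + ε) ≤ 2 + C₁ * m := by
    have := mul_le_mul_of_nonneg_left hem (by linarith : 0 ≤ C₁)
    linarith
  have h2 : C₁ ^ 2 * e ^ 2 + ε ^ 2 ≤ (C₁ * e + ε) ^ 2 := by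
    have := mul_nonneg h0 hε.le
    linarith
  have h3 : (C₁ ^ 2 * e ^ 2 + ε ^ 2) / (2 + C₁ * m)
      ≤ (C₁ * e + ε) ^ 2 / (1 + (C₁ * e + ε)) := by
    gcongr
  have h4 := div_le_div_of_nonneg_right h3 (show 0 ≤ 100 * K by positivity)
  have hpos : 0 < 2 + C₁ * m := by positivity
  have h5 : (C₁ ^ 2 * e ^ 2 + ε ^ 2) / (2 + C₁ * m) / (100 * K)
      = C₁ ^ 2 / (100 * K * (2 + C₁ * m)) * e ^ 2 + ε ^ 2 / (100 * K * (2 + C₁ * m)) := by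
    field_simp
  -- The choice of `C₁` gives `C₁² = 125K · C₁(2 + m) ≥ 125K(2 + C₁m)`. Of the resulting `5/4`, one
  -- quarter pays for the noise `e²/4` and the rest supplies the summand `e²`.
  have h6 : 5 / 4 ≤ C₁ ^ 2 / (100 * K * (2 + C₁ * m)) := by
    rw [le_div_iff₀ (by positivity)]
    have h7 : 2 + C₁ * m ≤ C₁ * (2 + m) := by linarith
    have h8 := mul_le_mul_of_nonneg_left h7 (show 0 ≤ 125 * K by positivity)
    have h9 : 125 * K * (C₁ * (2 + m)) = C₁ ^ 2 := by rw [sq]; nth_rw 2 [← hC]; ring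
    linarith
  have h10 := mul_le_mul_of_nonneg_right h6 (sq_nonneg e)
  linarith

theorem Assumptions.exists_iterateLaw_small_gradient {d : ℕ} {I Θ : Type*} [MeasurableSpace I]
    [Countable I] [DiscreteMeasurableSpace I] [MeasurableSpace Θ] {p : Measure I}
    [IsProbabilityMeasure p] {D : I → Measure Θ} [∀ i, IsProbabilityMeasure (D i)]
    {ℓ : I → Param d → Θ → ℝ} {L ρ σ σt α : ℝ} {B Din Do B' Dβ : ℕ} {w₀ : Param d}
    (H : Assumptions p D ℓ L ρ σ σt α) (hbdd : BddBelow (Set.range (metaLoss p D ℓ α)))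
    (hB : 20 ≤ B) (hin : 0 < Din) (ho : 0 < Do) (hB' : 0 < B') (hβ : 0 < Dβ)
    (h1 : ⌈(1 / 2) * (ρ * α * σ / L) ^ 2⌉₊ ≤ B') (h2 : ⌈(2 * ρ * α * σt / L) ^ 2⌉₊ ≤ Dβ)
    {c c₂ K C₁ ε : ℝ} (hc : ρ * α / L ≤ c) (hc0 : 0 ≤ c) (hc₂ : σ ^ 2 + σt ^ 2 ≤ c₂)
    (hK : 4 + 3 * c * (1 + √c₂) = K) (hC : 125 * K * (2 + √(2 * c₂)) = C₁)
    (hε : 0 < ε) (hε1 : ε < 1) :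
    ∃ k : ℕ, k * (noiseSq L σ σt α B Din Do + ε ^ 2 / (100 * K * (2 + C₁ * √(2 * c₂))))
        ≤ L * (metaLoss p D ℓ α w₀ - ⨅ w, metaLoss p D ℓ α w) ∧
      ∫ w, ‖∇ (metaLoss p D ℓ α) w‖ ∂(iterateLaw p D ℓ L ρ α B Din Do B' Dβ w₀ k)
        ≤ C₁ * √(noiseSq L σ σt α B Din Do) + ε := by
  have hL := H.L_pos
  have hK4 : 4 ≤ K := by
    have : 0 ≤ 3 * c * (1 + √c₂) := by positivity
    linarith
  have hσ : σ ≤ √c₂ := Real.le_sqrt_of_sq_le (by linarith [sq_nonneg σt])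
  have hK' : 4 + 3 * c * (1 + σ) ≤ K := by
    have := mul_le_mul_of_nonneg_left hσ (show 0 ≤ 3 * c by positivity)
    linarith
  set m := √(2 * c₂) with hm
  have hm0 : 0 ≤ m := Real.sqrt_nonneg _
  have hC1 : 1 ≤ C₁ := by
    have := mul_nonneg (show 0 ≤ K by linarith) hm0
    linarith
  have he0 := noiseSq_nonneg L σ σt α B Din Do
  set e := √(noiseSq L σ σt α B Din Do) with he
  have hee : e ^ 2 = noiseSq L σ σt α B Din Do := Real.sq_sqrt he0
  have hen : 0 ≤ e := Real.sqrt_nonneg _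
  have hem : e ≤ m := Real.sqrt_le_sqrt
    (noiseSq_le hL.le H.alpha_nonneg H.alpha_mul_le hc₂ hB hin ho)
  have hM : 0 ≤ C₁ * e + ε := by positivity
  have hamount := le_descent_amount (by linarith : 0 < K) hm0 hC hC1 hen hem hε hε1
  rw [hee] at hamount
  set δ := noiseSq L σ σt α B Din Do + ε ^ 2 / (100 * K * (2 + C₁ * m))
  have hδ : 0 < δ := by
    have : 0 < ε ^ 2 / (100 * K * (2 + C₁ * m)) := by positivity
    linarith
  obtain ⟨k, hk1, hk2⟩ := exists_first_of_descent (δ := δ / L) (M := C₁ * e + ε)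
    (b := ⨅ w, metaLoss p D ℓ α w)
    (F := fun k => ∫ w, metaLoss p D ℓ α w ∂(iterateLaw p D ℓ L ρ α B Din Do B' Dβ w₀ k))
    (g := fun k => ∫ w, ‖∇ (metaLoss p D ℓ α) w‖
      ∂(iterateLaw p D ℓ L ρ α B Din Do B' Dβ w₀ k))
    (by positivity)
    (fun k => by
      have := H.isProbabilityMeasure_iterateLaw (B := B) (Din := Din) (Do := Do) (B' := B')
        (Dβ := Dβ) (w₀ := w₀) k
      have hF := H.integrable_metaLoss_of_integrable_norm_sq aemeasurable_id
        (H.integrable_norm_sq_iterateLaw (B' := B') (Dβ := Dβ) (w₀ := w₀) hB hin ho k)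
      have := integral_mono (integrable_const (⨅ w, metaLoss p D ℓ α w)) hF
        fun w => ciInf_le hbdd w
      simpa using this)
    (fun k hk => by
      refine (H.integral_metaLoss_iterateLaw_succ_le hB hin ho hB' hβ h1 h2 hc hK' (by linarith)
        hM k hk).trans ?_
      have := div_le_div_of_nonneg_right hamount hL.le
      linarith)
  refine ⟨k, ?_, hk2⟩
  have hF0 : ∫ w, metaLoss p D ℓ α w ∂(iterateLaw p D ℓ L ρ α B Din Do B' Dβ w₀ 0)
      = metaLoss p D ℓ α w₀ := integral_dirac _ _
  simp only [hF0] at hk1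
  rw [← mul_div_assoc, div_le_iff₀ hL] at hk1
  linarith

/-- Conversion of the total decrease into the iteration bound. -/
theorem natCast_le_mul_min {k : ℕ} {n κ a r Δ L ε C : ℝ} (hL : 0 < L) (hε : 0 < ε) (hκ : 0 < κ)
    (ha : 0 < a) (han : a ≤ n) (hr : 0 ≤ r) (hκC : κ ≤ C) (hC : 1 ≤ C) (hΔ : 0 ≤ Δ)
    (h : k * (n + ε ^ 2 / κ) ≤ L * Δ) : (k : ℝ) ≤ C * Δ * min (L / ε ^ 2) (L / a + r) := by
  have hk : (0 : ℝ) ≤ k := Nat.cast_nonneg k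
  have hn : 0 < n := ha.trans_le han
  have h1 : k * (ε ^ 2 / κ) ≤ L * Δ := le_trans (by gcongr; linarith) h
  have h2 : k * a ≤ L * Δ := le_trans
    (mul_le_mul_of_nonneg_left (by have : 0 ≤ ε ^ 2 / κ := by positivity
                                   linarith) hk) h
  rw [mul_min_of_nonneg _ _ (by positivity)]
  refine le_min ?_ ?_
  · rw [← mul_div_assoc, le_div_iff₀ (by positivity)]
    rw [← mul_div_assoc, div_le_iff₀ hκ] at h1
    have := mul_le_mul_of_nonneg_left hκC (show 0 ≤ L * Δ by positivity)
    linarith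
  · have h3 : (k : ℝ) ≤ Δ * (L / a) := by
      rw [← mul_div_assoc, le_div_iff₀ ha]; linarith
    have h4 : Δ * (L / a) ≤ C * (Δ * (L / a)) := le_mul_of_one_le_left (by positivity) hC
    have h5 : 0 ≤ C * Δ * r := by positivity
    linarith

end FOMAML

end

/-! ### Assembly of the theorem. -/

theorem theorem3 (c₁ c₂ : ℝ) :
    ∃ C : ℝ, 0 < C ∧
      ∀ (d : ℕ) (I Θ Ω : Type*)
        [MeasurableSpace I] [Countable I] [DiscreteMeasurableSpace I]
        [MeasurableSpace Θ] [MeasurableSpace Ω]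
        -- task distribution, data distributions, sample losses, underlying probability space
        (p : Measure I) [IsProbabilityMeasure p]
        (D : I → Measure Θ) [∀ i, IsProbabilityMeasure (D i)]
        (ℓ : I → FOMAML.Param d → Θ → ℝ)
        (P : Measure Ω) [IsProbabilityMeasure P]
        (L ρ σ σt α : ℝ) (B Din Do B' Dβ : ℕ) (w₀ : FOMAML.Param d)
        (S : ℕ → Ω → FOMAML.Draw I Θ B Din Do B' Dβ),
        -- the losses are well defined, the sample losses are differentiable in the parameter
        (∀ i w, Measurable (ℓ i w)) →
        (∀ i θ, Differentiable ℝ (fun w => ℓ i w θ)) →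
        (∀ i w, Integrable (ℓ i w) (D i)) →
        (∀ w, Integrable (fun i => FOMAML.taskLoss D ℓ i w) p) →
        -- parameters
        0 < L → 0 ≤ ρ → 0 < σ → 0 ≤ σt →
        0 < α → α ≤ 1 / (10 * L) →
        -- the objective is bounded below
        BddBelow (Set.range (FOMAML.metaLoss p D ℓ α)) →
        -- every task loss is twice continuously differentiable and `L`-smooth
        (∀ i, ContDiff ℝ 2 (FOMAML.taskLoss D ℓ i)) →
        (∀ i w u, ‖∇ (FOMAML.taskLoss D ℓ i) w - ∇ (FOMAML.taskLoss D ℓ i) u‖ ≤ L * ‖w - u‖) →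
        -- every Hessian is `ρ`-Lipschitz
        (∀ i w u, ‖FOMAML.hessian (FOMAML.taskLoss D ℓ i) w
            - FOMAML.hessian (FOMAML.taskLoss D ℓ i) u‖ ≤ ρ * ‖w - u‖) →
        -- bounded variance of the task gradients
        (∀ w, Integrable (fun i =>
              ‖∇ (FOMAML.meanLoss p D ℓ) w - ∇ (FOMAML.taskLoss D ℓ i) w‖ ^ 2) p ∧
            ∫ i, ‖∇ (FOMAML.meanLoss p D ℓ) w - ∇ (FOMAML.taskLoss D ℓ i) w‖ ^ 2 ∂p ≤ σ ^ 2) →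
        -- the stochastic gradients are unbiased and have bounded variance
        (∀ i w, ∫ θ, FOMAML.sampleGrad ℓ i w θ ∂(D i) = ∇ (FOMAML.taskLoss D ℓ i) w) →
        (∀ i w, Integrable (fun θ =>
              ‖FOMAML.sampleGrad ℓ i w θ - ∇ (FOMAML.taskLoss D ℓ i) w‖ ^ 2) (D i) ∧
            ∫ θ, ‖FOMAML.sampleGrad ℓ i w θ - ∇ (FOMAML.taskLoss D ℓ i) w‖ ^ 2 ∂(D i)
              ≤ σt ^ 2) →
        -- relation of the parameters
        ρ * α / L ≤ c₁ → σ ^ 2 + σt ^ 2 ≤ c₂ →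
        -- batch sizes
        20 ≤ B → 0 < Din → 0 < Do → 0 < B' → 0 < Dβ →
        ⌈(1 / 2) * (ρ * α * σ / L) ^ 2⌉₊ ≤ B' → ⌈(2 * ρ * α * σt / L) ^ 2⌉₊ ≤ Dβ →
        -- the draws of different iterations are independent and have the prescribed law
        iIndepFun S P →
        (∀ k, HasLaw (S k) (FOMAML.drawLaw p D B Din Do B' Dβ) P) →
        -- the objective is well defined and differentiable
        (∀ w, Integrable (fun i => FOMAML.adaptedLoss D ℓ α i w) p) ∧
        Differentiable ℝ (FOMAML.metaLoss p D ℓ α) ∧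
        -- accuracy and number of iterations
        ∀ ε : ℝ, 0 < ε → ε < 1 →
          ∃ k : ℕ,
            (k : ℝ) ≤ C * (FOMAML.metaLoss p D ℓ α w₀ - ⨅ w, FOMAML.metaLoss p D ℓ α w) *
              min (L / ε ^ 2)
                (L / (σ ^ 2 * (α ^ 2 * L ^ 2 + 1 / B)) + L * (B * Do + Din) / σt ^ 2) ∧
            Integrable (fun ω =>
              ‖∇ (FOMAML.metaLoss p D ℓ α) (FOMAML.iterate ℓ L ρ α S w₀ k ω)‖) P ∧
            ∫ ω, ‖∇ (FOMAML.metaLoss p D ℓ α) (FOMAML.iterate ℓ L ρ α S w₀ k ω)‖ ∂P ≤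
              C * √(σ ^ 2 * (α ^ 2 * L ^ 2 + 1 / B) + σt ^ 2 / (B * Do) + σt ^ 2 / Din)
                + ε := by
  -- The absolute value keeps `K ≥ 4` for every real `c₁`. Below, `√c₂` bounds `σ` and `√(2 * c₂)`
  -- bounds the square root of the noise level, so all constants depend on `c₁` and `c₂` alone.
  set K : ℝ := 4 + 3 * |c₁| * (1 + √c₂) with hK
  set C₁ : ℝ := 125 * K * (2 + √(2 * c₂)) with hC₁
  set κ : ℝ := 100 * K * (2 + C₁ * √(2 * c₂)) with hκ
  have hK4 : 4 ≤ K := by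
    have : 0 ≤ 3 * |c₁| * (1 + √c₂) := by positivity
    linarith
  have hC1 : 1 ≤ C₁ := by
    have := mul_nonneg (show 0 ≤ K by linarith) (Real.sqrt_nonneg (2 * c₂))
    linarith
  have hκ0 : 0 < κ := by positivity
  refine ⟨C₁ + κ, by linarith, ?_⟩
  intro d I Θ Ω _ _ _ _ _ p _ D _ ℓ P _ L ρ σ σt α B Din Do B' Dβ w₀ S hmeas hdiff _ hint hL hρ hσ
    hσt hα hαL hbdd hC2 hsmooth hhess hvar hunb hsvar hc₁ hc₂ hB hin ho hB' hβ hB'2 hβ2 hind hlaw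
  have H : FOMAML.Assumptions p D ℓ L ρ σ σt α :=
    { measurable_loss := hmeas
      differentiable_loss := hdiff
      integrable_taskLoss := hint
      L_pos := hL
      rho_nonneg := hρ
      sigma_nonneg := hσ.le
      sigmat_nonneg := hσt
      alpha_nonneg := hα.le
      alpha_mul_le := by
        rw [le_div_iff₀ (by positivity)] at hαL
        linarith
      contDiff := hC2
      smooth := hsmooth
      hessian_lipschitz := hhess
      integrable_task_variance := fun w => (hvar w).1
      task_variance_le := fun w => (hvar w).2
      unbiased := hunb
      integrable_sample_variance := fun i w => (hsvar i w).1
      sample_variance_le := fun i w => (hsvar i w).2 }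
  refine ⟨H.integrable_adaptedLoss, fun w => (H.hasGradientAt_metaLoss w).differentiableAt,
    fun ε hε hε1 => ?_⟩
  obtain ⟨k, hk1, hk2⟩ := H.exists_iterateLaw_small_gradient (w₀ := w₀) hbdd hB hin ho hB' hβ hB'2
    hβ2 (hc₁.trans (le_abs_self c₁)) (abs_nonneg c₁) hc₂ hK.symm hC₁.symm hε hε1
  have hk := H.hasLaw_iterate (w₀ := w₀) hind hlaw k
  have hG := H.integrable_norm_gradient_iterateLaw (B' := B') (Dβ := Dβ) (w₀ := w₀) hB hin ho k
  rw [← hk.map_eq] at hG hk2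
  rw [integral_map hk.aemeasurable hG.1] at hk2
  have hBr : (0 : ℝ) < B := by exact_mod_cast (by omega : 0 < B)
  refine ⟨k, ?_, (integrable_map_measure hG.1 hk.aemeasurable).1 hG, hk2.trans ?_⟩
  -- The `σ` part of the noise level alone gives the second entry of the minimum; the summand with
  -- `σt` is nonnegative slack. For `σt = 0` it equals zero by the convention on division, which
  -- agrees with omitting it.
  · refine FOMAML.natCast_le_mul_min hL hε hκ0 (by positivity) ?_ (by positivity)
      (by linarith : κ ≤ C₁ + κ) (by linarith) (sub_nonneg.2 (ciInf_le hbdd w₀)) hk1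
    rw [FOMAML.noiseSq, add_assoc]
    exact le_add_of_nonneg_right (by positivity)
  · rw [FOMAML.noiseSq]
    gcongr
    linarith
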